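/- **Setting.** Let $\mathcal X,\mathcal A$ be finite, $N,T\ge 1$, and let $p=(p_n)_{n=1}^N$ be transition kernels, $p_n(\cdot\mid x,a)\in\Delta_{\mathcal X}$. For a policy $\pi=(\pi_n)_{n=1}^N$, $\pi_n(\cdot\mid x)\in\Delta_{\mathcal A}$, let $P_\pi$ be the transition matrix on $\mathcal X\times\mathcal A$ of one episode, i.e. the product over $n=1,\dots,N$ of the matrices $\big(p_n(x'\mid x,a)\,\pi_n(a'\mid x')\big)_{(x,a),(x',a')}$. For a kernel $q$ and an initial vector $\nu$ let $\mu^{\pi,q,\nu}=(\mu_0,\dots,\mu_N)$ be given by $\mu_0=\nu$, $\mu_{n+1}(x,a)=\sum_{x',a'}\mu_n(x',a')q_{n+1}(x\mid x',a')\pi_{n+1}(a\mid x)$, and let $\mathcal M^q_\nu$ be the set of nonnegative sequences $(\mu_n)_{n=0}^N$ with $\mu_0=\nu$ and $\sum_a\mu_{n+1}(x,a)=\sum_{x',a'}\mu_n(x',a')q_{n+1}(x\mid x',a')$. Let $\rho\in\Delta_{\mathcal X\times\mathcal A}$. A policy is *periodic* if $\rho P_\pi=\rho$. Assume that a periodic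 policy exists and that for some $\alpha\in[0,1)$ every periodic policy satisfies $\|\nu P_\pi-\nu'P_\pi\|_1\le\alpha\|\nu-\nu'\|_1$ for all distributions $\nu,\nu'$. **Protocol (no resets).** Finitely many agents start i.i.d. from $\rho$. In episode $t=1,\dots,T$ all agents play the policy $\pi_t$, moving independently under $p$; each starts an episode where it ended the previous one. In each episode the trajectory $(x_{t,n},a_{t,n})_{n=0}^N$ of one selected agent is observed. The policy $\pi_t$ is a function of the learner's information $\mathcal F_t$ before episode $t$ (containing the previously observed trajectories). Put $\rho_1=\rho$, $\rho_{t+1}=\rho_tP_{\pi_t}$. The observations are independent in the sense that, given $\mathcal F_t$, the initial pair of the agent observed in episode $t$ is distributed according to $\rho_t$. **Algorithm MDPP-K.** Let $\delta\in(0,1)$, $\eta>0$. Let $N_{t,n}(x,a)$ and $M_{t,n}(x'\mid x,a)$ be the numbers of $s<t$ with $(x_{s,n},a_{s,n})=(x,a)$, respectively with also $x_{s,n+1}=x'$. Put $\hat p_{1,n+1}=1/|\mathcal X|$ and $\hat p_{t,n+1}(x'\mid x,a)=M_{t,n}(x'\mid x,a)/\max\{1,N_{t,n}(x,a)\}$ for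 $t\ge2$. For $0\le n<N$ put $b_{t,n}=C_\delta/\sqrt{\max\{1,N_{t,n}\}}$ with $C_\delta=\sqrt{2|\mathcal X|\log(|\mathcal X||\mathcal A|NT/\delta)}$, and $\bar b_{t,n}=\ell(N-n)\,b_{t,n}$. The losses $F_t(\mu)=\sum_{n=1}^N f_{t,n}(\mu_n)$, with $f_{t,n}$ convex and $\ell$-Lipschitz for $\|\cdot\|_1$, are arbitrary (possibly adaptive). Let $\mu_t=\mu^{\pi_t,\hat p_t,\rho_t}$, let $\ell_t$ be a (sub)gradient of $F_t$ at $\mu_t$, and let $D_\psi(\mu,\mu')=\psi(\mu)-\psi(\mu')-\langle\nabla\psi(\mu'),\mu-\mu'\rangle$ be any Bregman divergence. The first policy $\pi_1$ is arbitrary. For $1\le t<T$, whenever the constraint set below is non-empty, $\pi_{t+1}$ is a policy for which $\mu_{t+1}$ solves $$\mu_{t+1}\in\arg\min_{\mu\in\mathcal M^{\hat p_{t+1}}_{\rho_{t+1}}}\ \eta\langle\ell_t-\bar b_t,\mu\rangle+D_\psi(\mu,\mu_t)\quad\text{s.t.}\quad\|\mu_N-\rho\|_1\le\langle\mu,b_{t+1}\rangle+\alpha\|\rho_{t+1}-\rho\|_1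 ,$$ and $\pi_{t+1}$ is arbitrary otherwise. Here $\langle\mu,b\rangle=\sum_{n=0}^{N-1}\sum_{x,a}\mu_n(x,a)b_n(x,a)$. **Claim.** With probability at least $1-(2+T)\delta$, $$\sum_{t=1}^T\|\rho_{t+1}-\rho\|_1\le\frac{30N^2}{1-\alpha}|\mathcal X|^{3/2}\sqrt{|\mathcal A|T}\,\log\Big(\frac{|\mathcal X||\mathcal A|NT}{\delta}\Big)\sqrt{\log\Big(\frac N\delta\Big)} .$$ In particular, with high probability the sum is $\tilde O\big(N^2(1-\alpha)^{-1}|\mathcal X|^{3/2}\sqrt{|\mathcal A|T}\big)$. -/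

import Mathlib

open MeasureTheory ProbabilityTheory
open scoped Matrix

namespace PeriodicMDP

variable {X A J Ω : Type*} [Fintype X] [Fintype A] [DecidableEq X] [DecidableEq A]

/-- The `L₁` norm on functions on a finite set. -/
def l1 {ι : Type*} [Fintype ι] (v : ι → ℝ) : ℝ := ∑ i, |v i|

/-- Transition kernels: `p n (x, a) x₁` is the probability of moving from `(x, a)` at time step `n`
to `x₁` at time step `n + 1`, that is, `p_{n+1}(x₁ | x, a)`. -/
abbrev Kernel (X A : Type*) (N : ℕ) := Fin N → X × A → X → ℝ

/-- Policies: `π n x a` is the probability of action `a` in state `x` at time step `n + 1`,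
that is, `π_{n+1}(a | x)`. -/
abbrev Policy (X A : Type*) (N : ℕ) := Fin N → X → A → ℝ

/-- Sequences `μ_0, …, μ_N` of functions on state-action pairs. -/
abbrev Occ (X A : Type*) (N : ℕ) := Fin (N + 1) → X × A → ℝ

/-- Trajectories `(x_0, a_0), …, (x_N, a_N)` of one episode. -/
abbrev Traj (X A : Type*) (N : ℕ) := Fin (N + 1) → X × A

/-- Every row of `p` is a probability distribution on states. -/
def IsKernel {N : ℕ} (p : Kernel X A N) : Prop := ∀ n y, p n y ∈ stdSimplex ℝ X

/-- Every row of `π` is a probability distribution on actions. -/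
def IsPolicy {N : ℕ} (π : Policy X A N) : Prop := ∀ n x, π n x ∈ stdSimplex ℝ A

/-- One-step transition matrix on state-action pairs. -/
def stepMatrix {N : ℕ} (p : Kernel X A N) (π : Policy X A N) (n : Fin N) :
    Matrix (X × A) (X × A) ℝ :=
  Matrix.of fun y z => p n y z.1 * π n z.1 z.2

/-- The product of the first `n` one-step matrices. -/
def partialMatrix {N : ℕ} (p : Kernel X A N) (π : Policy X A N) (n : Fin (N + 1)) :
    Matrix (X × A) (X × A) ℝ :=
  Fin.induction (motive := fun _ => Matrix (X × A) (X × A) ℝ) 1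
    (fun i M => M * stepMatrix p π i) n

/-- The transition matrix `P_π` of a whole episode. -/
def episodeMatrix {N : ℕ} (p : Kernel X A N) (π : Policy X A N) : Matrix (X × A) (X × A) ℝ :=
  partialMatrix p π (Fin.last N)

/-- The state-action distribution sequence induced by `π` under the kernel `p` from the initial
distribution `ν`: `μ_0 = ν` and
`μ_{n+1}(x, a) = ∑_{y} μ_n(y) p_{n+1}(x | y) π_{n+1}(a | x)`. -/
def occ {N : ℕ} (p : Kernel X A N) (π : Policy X A N) (ν : X × A → ℝ) : Occ X A N := fun n =>
  Fin.induction (motive := fun _ => X × A → ℝ) ν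
    (fun i μ => fun z => ∑ y, μ y * (p i y z.1 * π i z.1 z.2)) n

/-- The set `M^p_ν` of nonnegative sequences that start at `ν` and satisfy the flow equations
of `p`. -/
def flowSet {N : ℕ} (p : Kernel X A N) (ν : X × A → ℝ) : Set (Occ X A N) :=
  {μ | (∀ n y, 0 ≤ μ n y) ∧ μ 0 = ν ∧
    ∀ (n : Fin N) (x : X), ∑ a, μ n.succ (x, a) = ∑ y, μ n.castSucc y * p n y x}

/-- A policy is periodic for `ρ` if `ρ P_π = ρ`. -/
def IsPeriodic {N : ℕ} (p : Kernel X A N) (ρ : X × A → ℝ) (π : Policy X A N) : Prop :=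
  IsPolicy π ∧ ρ ᵥ* episodeMatrix p π = ρ

/-- `P_π` is an `α`-contraction in `L₁` on distributions, for every periodic policy `π`. -/
def PeriodicContraction {N : ℕ} (p : Kernel X A N) (ρ : X × A → ℝ) (α : ℝ) : Prop :=
  ∀ π : Policy X A N, IsPeriodic p ρ π →
    ∀ ν ∈ stdSimplex ℝ (X × A), ∀ ν₁ ∈ stdSimplex ℝ (X × A),
      l1 (ν ᵥ* episodeMatrix p π - ν₁ ᵥ* episodeMatrix p π) ≤ α * l1 (ν - ν₁)

/-- The initial distributions of the episodes when nothing is reset: the first is `ρ`, the next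
one is obtained from the current one through `P_{π_t}`. Episodes are numbered from `0`. -/
def initDist {N : ℕ} (p : Kernel X A N) (ρ : X × A → ℝ) (π : ℕ → Policy X A N) : ℕ → X × A → ℝ
  | 0 => ρ
  | t + 1 => initDist p ρ π t ᵥ* episodeMatrix p (π t)

/-- Probability that an agent that starts at `z 0` and plays `π` follows the trajectory `z`. -/
def pathProb {N : ℕ} (p : Kernel X A N) (π : Policy X A N) (z : Traj X A N) : ℝ :=
  ∏ n : Fin N, stepMatrix p π n (z n.castSucc) (z n.succ)

/-! ### Estimation from the observed trajectories `o 0, o 1, …` -/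

/-- `N_{t,n}(y)`: visits of `y` at time step `n` before episode `t`. -/
def visits {N : ℕ} (o : ℕ → Traj X A N) (t : ℕ) (n : Fin N) (y : X × A) : ℕ :=
  ((Finset.range t).filter fun s => o s n.castSucc = y).card

/-- `M_{t,n}(x | y)`: visits of `y` at time step `n` followed by `x`, before episode `t`. -/
def moves {N : ℕ} (o : ℕ → Traj X A N) (t : ℕ) (n : Fin N) (y : X × A) (x : X) : ℕ :=
  ((Finset.range t).filter fun s => o s n.castSucc = y ∧ (o s n.succ).1 = x).card

/-- The estimated kernel of episode `t`: uniform in the first episode, then the ratio of the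
counts. -/
noncomputable def estKernel {N : ℕ} (o : ℕ → Traj X A N) (t : ℕ) : Kernel X A N := fun n y x =>
  if t = 0 then 1 / (Fintype.card X : ℝ)
  else (moves o t n y x : ℝ) / max 1 (visits o t n y : ℝ)

/-- `C_δ = √(2 |X| log(|X| |A| N T / δ))`. -/
noncomputable def bonusConst (X A : Type*) [Fintype X] [Fintype A] (N T : ℕ) (δ : ℝ) : ℝ :=
  Real.sqrt (2 * (Fintype.card X : ℝ) *
    Real.log ((Fintype.card X : ℝ) * (Fintype.card A : ℝ) * (N : ℝ) * (T : ℝ) / δ))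

/-- The bonus `b_{t,n}(y)`, `n = 0, …, N - 1`. -/
noncomputable def bonus {N : ℕ} (T : ℕ) (δ : ℝ) (o : ℕ → Traj X A N) (t : ℕ) (n : Fin N)
    (y : X × A) : ℝ :=
  bonusConst X A N T δ / Real.sqrt (max 1 (visits o t n y : ℝ))

/-- The pairing `⟨μ, b⟩ = ∑_{n=0}^{N-1} ∑_y μ_n(y) b_n(y)`. -/
def pairBonus {N : ℕ} (μ : Occ X A N) (b : Fin N → X × A → ℝ) : ℝ :=
  ∑ n : Fin N, ∑ y, μ n.castSucc y * b n y

/-! ### The constrained mirror descent step -/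

/-- The constraint set of the problem solved for episode `t`: sequences in `M^{p̂_t}_{ρ_t}` with
`‖μ_N - ρ‖₁ ≤ ⟨μ, b_t⟩ + α ‖ρ_t - ρ‖₁`. Here `π` is the sequence of policies (only those before
episode `t` matter) and `o` the sequence of observed trajectories. -/
def feasibleSet {N : ℕ} (p : Kernel X A N) (ρ : X × A → ℝ) (T : ℕ) (δ α : ℝ)
    (o : ℕ → Traj X A N) (π : ℕ → Policy X A N) (t : ℕ) : Set (Occ X A N) :=
  {μ | μ ∈ flowSet (estKernel o t) (initDist p ρ π t) ∧
    l1 (μ (Fin.last N) - ρ) ≤ pairBonus μ (bonus T δ o t) + α * l1 (initDist p ρ π t - ρ)}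

/-- `μ_t`, the sequence induced by `π_t` from `ρ_t` under the estimated kernel. -/
noncomputable def estOcc {N : ℕ} (p : Kernel X A N) (ρ : X × A → ℝ)
    (o : ℕ → Traj X A N) (π : ℕ → Policy X A N) (t : ℕ) : Occ X A N :=
  occ (estKernel o t) (π t) (initDist p ρ π t)

/-- The Bregman divergence `ψ(μ) - ψ(μ₀) - ⟨h, μ - μ₀⟩`, where `h` is the gradient of `ψ`
at `μ₀`. -/
def bregman {N : ℕ} (ψ : Occ X A N → ℝ) (h : Occ X A N) (μ μ₀ : Occ X A N) : ℝ :=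
  ψ μ - ψ μ₀ - ∑ n, ∑ y, h n y * (μ n y - μ₀ n y)

/-- `h` is the gradient of `ψ` at `μ₀`. Where `ψ` is not differentiable (as for entropies at
sequences with zero entries) nothing is required, so that every convention is covered. -/
def IsGradientAt {N : ℕ} (ψ : Occ X A N → ℝ) (h μ₀ : Occ X A N) : Prop :=
  DifferentiableAt ℝ ψ μ₀ → ∀ v : Occ X A N, fderiv ℝ ψ μ₀ v = ∑ n, ∑ y, h n y * v n y

/-- `g` is a subgradient of `f` at `u` (the gradient, if `f` is convex and differentiable). -/
def IsSubgradientAt {ι : Type*} [Fintype ι] (f : (ι → ℝ) → ℝ) (g u : ι → ℝ) : Prop :=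
  ∀ v, f u + ∑ i, g i * (v i - u i) ≤ f v

/-- The objective `η ⟨ℓ_t - b̄_t, μ⟩ + D_ψ(μ, μ_t)` minimized at the end of episode `t`. Here `g n`
is the gradient of `f_{t,n+1}` at `μ_{t,n+1}`, and `b̄_{t,n} = ℓ (N - n) b_{t,n}`, which vanishes
for `n = N`. -/
noncomputable def objective {N : ℕ} (T : ℕ) (δ η ℓ : ℝ) (ψ : Occ X A N → ℝ) (h : Occ X A N)
    (g : Fin N → X × A → ℝ) (o : ℕ → Traj X A N) (t : ℕ) (μ₀ μ : Occ X A N) : ℝ :=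
  η * (∑ n : Fin N, ∑ y, g n y * μ n.succ y
      - pairBonus μ (fun n y => ℓ * ((N : ℝ) - ((n : ℕ) : ℝ)) * bonus T δ o t n y))
    + bregman ψ h μ μ₀

/-! ### The online protocol and the algorithm -/

/-- The trajectories of the selected agents. -/
def observed {N : ℕ} (Z : ℕ → J → Ω → Traj X A N) (sel : ℕ → Ω → J) (ω : Ω) : ℕ → Traj X A N :=
  fun t => Z t (sel t ω) ω

/-- The multi-agent protocol without resets over the episodes `0, …, T - 1`. `Z t j` is the
trajectory of agent `j` in episode `t`, `sel t` the agent observed in episode `t`, `π t` the policy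
that all agents play in episode `t`; `ℱ t` is the information of the learner before episode `t`,
and `𝒢 t` records all that is settled when episode `t` starts. -/
structure IsProtocol [Fintype J] {mΩ : MeasurableSpace Ω} (P : Measure Ω) {N : ℕ}
    (p : Kernel X A N) (ρ : X × A → ℝ) (T : ℕ) (ℱ 𝒢 : Filtration ℕ mΩ)
    (Z : ℕ → J → Ω → Traj X A N) (sel : ℕ → Ω → J) (π : ℕ → Ω → Policy X A N) : Prop where
  info_le : ∀ t ≤ T, ℱ t ≤ 𝒢 t
  /-- The learner has seen the previously observed trajectories. -/
  observed_meas : ∀ t ≤ T, ∀ s < t, ∀ z : Traj X A N,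
    MeasurableSet[ℱ t] {ω | observed Z sel ω s = z}
  /-- The learner plays policies, chosen from its information. -/
  policy : ∀ t < T, ∀ ω, IsPolicy (π t ω)
  policy_meas : ∀ t < T, Measurable[ℱ t] (π t)
  past_meas : ∀ t ≤ T, ∀ s < t, ∀ (j : J) (z : Traj X A N), MeasurableSet[𝒢 t] {ω | Z s j ω = z}
  start_meas : ∀ t < T, ∀ (j : J) (y : X × A), MeasurableSet[𝒢 t] {ω | Z t j ω 0 = y}
  sel_meas : ∀ t < T, ∀ j : J, MeasurableSet[𝒢 t] {ω | sel t ω = j}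
  /-- In the first episode the agents start independently of each other from `ρ`. -/
  start : ∀ y : J → X × A, P.real {ω | ∀ j, Z 0 j ω 0 = y j} = ∏ j, ρ (y j)
  /-- No reset: an agent starts an episode where it ended the previous one. -/
  carry : ∀ t, t + 1 < T → ∀ (j : J) (ω : Ω), Z (t + 1) j ω 0 = Z t j ω (Fin.last N)
  /-- During an episode the agents move independently of each other, following the kernel `p`
  and the policy `π t`. -/
  move : ∀ t < T, ∀ z : J → Traj X A N,
    P⟦{ω | ∀ j, Z t j ω = z j} | 𝒢 t⟧ =ᵐ[P]
      Set.indicator {ω | ∀ j, Z t j ω 0 = z j 0} (fun ω => ∏ j, pathProb p (π t ω) (z j))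
  /-- The agent to be observed is selected such that its current state-action pair is a sample
  from `ρ_t` that is independent of the previous observations. -/
  indep : ∀ t < T, ∀ y : X × A,
    P⟦{ω | Z t (sel t ω) ω 0 = y} | ℱ t⟧ =ᵐ[P] fun ω => initDist p ρ (fun s => π s ω) t y

/-- The policies are those of the algorithm: the first one is arbitrary, and whenever the
constraint set of episode `t + 1` is not empty, `π (t + 1)` is a policy associated with a minimizer
of the objective over it. The losses `f t ω n` (which stands for `f_{t,n+1}`) may be chosen
adaptively; `g t ω n` is a (sub)gradient of `f t ω n`, and `h t ω` the gradient of `ψ`, at the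
current iterate. -/
structure IsMDPPK {N : ℕ} (p : Kernel X A N) (ρ : X × A → ℝ) (T : ℕ) (δ α η ℓ : ℝ)
    (ψ : Occ X A N → ℝ) (f : ℕ → Ω → Fin N → (X × A → ℝ) → ℝ) (g : ℕ → Ω → Fin N → X × A → ℝ)
    (h : ℕ → Ω → Occ X A N)
    (Z : ℕ → J → Ω → Traj X A N) (sel : ℕ → Ω → J) (π : ℕ → Ω → Policy X A N) : Prop where
  loss_convex : ∀ t < T, ∀ ω n, ConvexOn ℝ Set.univ (f t ω n)
  loss_lipschitz : ∀ t < T, ∀ ω n u v, |f t ω n u - f t ω n v| ≤ ℓ * l1 (u - v)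
  loss_grad : ∀ t < T, ∀ ω n, IsSubgradientAt (f t ω n) (g t ω n)
    (estOcc p ρ (observed Z sel ω) (fun s => π s ω) t n.succ)
  mirror_grad : ∀ t < T, ∀ ω,
    IsGradientAt ψ (h t ω) (estOcc p ρ (observed Z sel ω) (fun s => π s ω) t)
  update : ∀ t, t + 1 < T → ∀ ω,
    (feasibleSet p ρ T δ α (observed Z sel ω) (fun s => π s ω) (t + 1)).Nonempty →
      estOcc p ρ (observed Z sel ω) (fun s => π s ω) (t + 1) ∈
          feasibleSet p ρ T δ α (observed Z sel ω) (fun s => π s ω) (t + 1) ∧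
        IsMinOn
          (objective T δ η ℓ ψ (h t ω) (g t ω) (observed Z sel ω) t
            (estOcc p ρ (observed Z sel ω) (fun s => π s ω) t))
          (feasibleSet p ρ T δ α (observed Z sel ω) (fun s => π s ω) (t + 1))
          (estOcc p ρ (observed Z sel ω) (fun s => π s ω) (t + 1))

end PeriodicMDP

/-!
The bound is deterministic on two good events. On the first, before each episode but the first,
every row of the estimated kernel is within its bonus of the true row, in `L₁`. Then the sequence
that a periodic policy induces under the estimated kernel satisfies the constraint, so that the
constraint set is not empty and the next iterate obeys it. Comparing the estimated with the true
kernel once more, the distances `d_t = ‖ρ_t - ρ‖₁` satisfy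
`d_{t+1} ≤ α d_t + 2 ⟨μ_t, b_t⟩ ≤ α d_t + 2 (1 + N C_δ) ⟨μ^{π_t, p, ρ_t}, b_t⟩`, and summation turns
the contraction factor into `1 / (1 - α)`. On the second event the expected bonuses
`⟨μ^{π_t, p, ρ_t}, b_t⟩` exceed in total the observed ones by at most an Azuma-Hoeffding term, and
the observed ones add up like `∑ 1 / √k`.

Both events are controlled by Chernoff's bound for exponential supermartingales. For the first one,
fix a time step and a state-action pair: an `L₁` error above the bonus means that, for one of the
`2 ^ |X|` sign patterns on the states and for one of the `T` possible visit counts `m`, the centred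
sum of the signs of the states reached after the first `m` visits is large. Fixing `m` in advance
makes this a sum of martingale differences with at most `m` nonzero terms, so that the number of
visits need not be independent of the transitions. The two events fail with probability at most
`2 δ` and `δ`.
-/

namespace PeriodicMDP

/-! ### The `L₁` norm -/

section L1

variable {ι κ : Type*} [Fintype ι] [Fintype κ]

lemma l1_eq_norm_toLp (v : ι → ℝ) : l1 v = ‖WithLp.toLp 1 v‖ := by
  simp [l1, PiLp.norm_eq_of_L1]

lemma l1_nonneg (v : ι → ℝ) : 0 ≤ l1 v :=
  l1_eq_norm_toLp v ▸ norm_nonneg _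

lemma l1_sub_self (v : ι → ℝ) : l1 (v - v) = 0 := by
  simp [l1]

lemma l1_sub_comm (u v : ι → ℝ) : l1 (u - v) = l1 (v - u) := by
  simpa only [l1_eq_norm_toLp, WithLp.toLp_sub] using norm_sub_rev _ _

lemma l1_add_le (u v : ι → ℝ) : l1 (u + v) ≤ l1 u + l1 v := by
  simpa only [l1_eq_norm_toLp, WithLp.toLp_add] using norm_add_le _ _

lemma l1_sub_le (u v w : ι → ℝ) : l1 (u - w) ≤ l1 (u - v) + l1 (v - w) := by
  simpa only [sub_add_sub_cancel] using l1_add_le (u - v) (v - w)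

lemma l1_eq_sum_of_nonneg {v : ι → ℝ} (hv : ∀ i, 0 ≤ v i) : l1 v = ∑ i, v i :=
  Finset.sum_congr rfl fun i _ => abs_of_nonneg (hv i)

lemma l1_of_mem_stdSimplex {v : ι → ℝ} (hv : v ∈ stdSimplex ℝ ι) : l1 v = 1 :=
  (l1_eq_sum_of_nonneg hv.1).trans hv.2

lemma l1_sub_le_two {u v : ι → ℝ} (hu : u ∈ stdSimplex ℝ ι) (hv : v ∈ stdSimplex ℝ ι) :
    l1 (u - v) ≤ 2 := by
  have h := l1_sub_le u 0 v
  rw [l1_sub_comm 0 v, sub_zero, sub_zero, l1_of_mem_stdSimplex hu, l1_of_mem_stdSimplex hv] at h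
  linarith

lemma exists_units_sum_mul_eq_l1 (v : ι → ℝ) :
    ∃ s : ι → ℤˣ, ∑ i, v i * ((s i : ℤ) : ℝ) = l1 v := by
  have hsign : ∀ i, ∃ s : ℤˣ, v i * ((s : ℤ) : ℝ) = |v i| := fun i => by
    rcases abs_choice (v i) with h | h
    · exact ⟨1, by simp [h]⟩
    · exact ⟨-1, by simp [h]⟩
  choose s hs using hsign
  exact ⟨s, Finset.sum_congr rfl fun i _ => hs i⟩

lemma sum_mul_le_sum_mul_add_mul_l1_sub (u v : ι → ℝ) {b : ι → ℝ} {B : ℝ} (hb : ∀ i, |b i| ≤ B) :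
    ∑ i, u i * b i ≤ ∑ i, v i * b i + B * l1 (u - v) := by
  rw [l1, Finset.mul_sum, ← Finset.sum_add_distrib]
  refine Finset.sum_le_sum fun i _ => ?_
  have hterm : (u i - v i) * b i ≤ B * |(u - v) i| := by
    calc (u i - v i) * b i ≤ |u i - v i| * |b i| := (le_abs_self _).trans_eq (abs_mul _ _)
      _ ≤ |u i - v i| * B := mul_le_mul_of_nonneg_left (hb i) (abs_nonneg _)
      _ = B * |(u - v) i| := mul_comm _ _
  linarith

lemma l1_vecMul_le (v : ι → ℝ) (M : Matrix ι κ ℝ) : l1 (v ᵥ* M) ≤ ∑ i, |v i| * l1 (M i) :=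
  calc l1 (v ᵥ* M) ≤ ∑ k, ∑ i, |v i * M i k| :=
        Finset.sum_le_sum fun _ _ => Finset.abs_sum_le_sum_abs _ _
    _ = ∑ i, |v i| * l1 (M i) := by
        rw [Finset.sum_comm]
        simp only [abs_mul, ← Finset.mul_sum, l1]

end L1

/-! ### Inhomogeneous chains on a finite set -/

section Chain

variable {S R : Type*} [Fintype S] [CommSemiring R] {N : ℕ}

/-- The marginal at time `n` of the inhomogeneous chain with transition matrices `M` and initial
vector `ν`. The occupancy measures `occ p π ν` are the marginals of the chain `stepMatrix p π`. -/
def marginal (M : Fin N → Matrix S S R) (ν : S → R) (n : Fin (N + 1)) : S → R :=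
  Fin.induction (motive := fun _ => S → R) ν (fun i μ => μ ᵥ* M i) n

@[simp] lemma marginal_zero (M : Fin N → Matrix S S R) (ν : S → R) : marginal M ν 0 = ν := rfl

lemma marginal_succ (M : Fin N → Matrix S S R) (ν : S → R) (i : Fin N) :
    marginal M ν i.succ = marginal M ν i.castSucc ᵥ* M i := rfl

lemma marginal_castSucc (M : Fin (N + 1) → Matrix S S R) (ν : S → R) (n : Fin (N + 1)) :
    marginal M ν n.castSucc = marginal (fun i => M i.castSucc) ν n := by
  induction n using Fin.induction with
  | zero => rfl
  | succ i ih => rw [← Fin.succ_castSucc, marginal_succ, marginal_succ, ih]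

lemma marginal_congr {M M' : Fin N → Matrix S S R} (ν : S → R) {n : Fin (N + 1)}
    (h : ∀ i : Fin N, i.castSucc < n → M i = M' i) : marginal M ν n = marginal M' ν n := by
  induction n using Fin.induction with
  | zero => rfl
  | succ i ih =>
    rw [marginal_succ, marginal_succ, h i Fin.castSucc_lt_succ,
      ih fun k hk => h k (hk.trans Fin.castSucc_lt_succ)]

lemma sum_vecMul {M : Matrix S S R} (hM : ∀ u, ∑ v, M u v = 1) (ν : S → R) :
    ∑ v, (ν ᵥ* M) v = ∑ u, ν u := by
  simp only [Matrix.vecMul, dotProduct]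
  rw [Finset.sum_comm]
  simp only [← Finset.mul_sum, hM, mul_one]

lemma sum_marginal_eq_of_le {M : Fin N → Matrix S S R} (ν : S → R) {m n : Fin (N + 1)}
    (hmn : m ≤ n) (hM : ∀ i : Fin N, m ≤ i.castSucc → ∀ u, ∑ v, M i u v = 1) :
    ∑ u, marginal M ν n u = ∑ u, marginal M ν m u := by
  induction n using Fin.induction with
  | zero => rw [Fin.le_zero_iff.1 hmn]
  | succ i ih =>
    rcases hmn.eq_or_lt with rfl | hlt
    · rfl
    · have hmi : m ≤ i.castSucc := Fin.le_castSucc_iff.2 hlt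
      rw [marginal_succ, sum_vecMul (hM i hmi), ih hmi]

lemma sum_path_snoc (H : (Fin (N + 2) → S) → R) :
    ∑ z, H z = ∑ z : Fin (N + 1) → S, ∑ u, H (Fin.snoc z u) := by
  rw [← (Fin.snocEquiv fun _ : Fin (N + 2) => S).sum_comp, Fintype.sum_prod_type_right]
  rfl

lemma sum_path_mul_last (M : Fin N → Matrix S S R) (ν : S → R) (f : S → R) :
    ∑ z : Fin (N + 1) → S, ν (z 0) * (∏ i, M i (z i.castSucc) (z i.succ)) * f (z (Fin.last N)) =
      ∑ u, marginal M ν (Fin.last N) u * f u := by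
  induction N generalizing f with
  | zero =>
    rw [← (Equiv.funUnique (Fin 1) S).symm.sum_comp]
    simp
  | succ N ih =>
    have hlast : ∑ u, marginal M ν (Fin.last (N + 1)) u * f u =
        ∑ v, marginal (fun i => M i.castSucc) ν (Fin.last N) v *
          ∑ u, M (Fin.last N) v u * f u := by
      rw [← Fin.succ_last, marginal_succ, marginal_castSucc]
      simp only [Matrix.vecMul, dotProduct, Finset.sum_mul, Finset.mul_sum, mul_assoc]
      exact Finset.sum_comm
    rw [hlast, ← ih, sum_path_snoc]
    refine Finset.sum_congr rfl fun z _ => ?_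
    rw [Finset.mul_sum]
    refine Finset.sum_congr rfl fun u _ => ?_
    simp only [Fin.prod_univ_castSucc, Fin.succ_castSucc, Fin.succ_last, Fin.snoc_castSucc,
      Fin.snoc_last, ← Fin.castSucc_zero, mul_assoc]

lemma sum_path_mul_step {M : Fin N → Matrix S S R} (hM : ∀ i u, ∑ v, M i u v = 1) (ν : S → R)
    (n : Fin N) (G : S → S → R) :
    ∑ z : Fin (N + 1) → S, ν (z 0) * (∏ i, M i (z i.castSucc) (z i.succ)) *
      G (z n.castSucc) (z n.succ) = ∑ u, marginal M ν n.castSucc u * ∑ v, M n u v * G u v := by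
  -- The weight is absorbed into the `n`-th matrix, the only one that need not stay stochastic.
  let M' : Fin N → Matrix S S R := fun i => .of fun u v => M i u v * if i = n then G u v else 1
  have hM' : ∀ i ≠ n, M' i = M i := fun i hi => by ext; simp [M', hi]
  calc ∑ z : Fin (N + 1) → S, ν (z 0) * (∏ i, M i (z i.castSucc) (z i.succ)) *
        G (z n.castSucc) (z n.succ)
      = ∑ z : Fin (N + 1) → S, ν (z 0) * (∏ i, M' i (z i.castSucc) (z i.succ)) * 1 := by
        simp only [M', Matrix.of_apply, Finset.prod_mul_distrib, Finset.prod_ite_eq',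
          Finset.mem_univ, if_true, mul_one, mul_assoc]
    _ = ∑ u, marginal M' ν (Fin.last N) u := by
        simpa only [mul_one] using sum_path_mul_last M' ν fun _ => 1
    _ = ∑ u, marginal M' ν n.succ u :=
        sum_marginal_eq_of_le ν (Fin.le_last _) fun i hi => by
          rw [hM' i (Fin.succ_le_castSucc_iff.1 hi).ne']; exact hM i
    _ = ∑ v, ∑ u, marginal M ν n.castSucc u * (M n u v * G u v) := by
        rw [marginal_succ,
          marginal_congr ν fun i hi => hM' i (Fin.castSucc_lt_castSucc_iff.1 hi).ne]
        simp [M', Matrix.vecMul, dotProduct]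
    _ = ∑ u, marginal M ν n.castSucc u * ∑ v, M n u v * G u v := by
        rw [Finset.sum_comm]
        simp only [Finset.mul_sum]

lemma marginal_nonneg {M : Fin N → Matrix S S ℝ} (hM : ∀ i u v, 0 ≤ M i u v) {ν : S → ℝ}
    (hν : ∀ u, 0 ≤ ν u) (n : Fin (N + 1)) (u : S) : 0 ≤ marginal M ν n u := by
  induction n using Fin.induction generalizing u with
  | zero => exact hν u
  | succ i ih => exact Finset.sum_nonneg fun v _ => mul_nonneg (ih v) (hM i v u)

lemma marginal_mem_stdSimplex {M : Fin N → Matrix S S ℝ} (hM : ∀ i u, M i u ∈ stdSimplex ℝ S)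
    {ν : S → ℝ} (hν : ν ∈ stdSimplex ℝ S) (n : Fin (N + 1)) : marginal M ν n ∈ stdSimplex ℝ S :=
  ⟨marginal_nonneg (fun i u => (hM i u).1) hν.1 n,
    (sum_marginal_eq_of_le ν (Fin.zero_le n) fun i _ u => (hM i u).2).trans hν.2⟩

lemma l1_marginal_sub_marginal_le (M : Fin N → Matrix S S ℝ) {M' : Fin N → Matrix S S ℝ}
    (hM' : ∀ i u, l1 (M' i u) ≤ 1) (ν : S → ℝ) (n : Fin (N + 1)) :
    l1 (marginal M ν n - marginal M' ν n) ≤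
      ∑ i : Fin N with i.castSucc < n,
        ∑ u, |marginal M ν i.castSucc u| * l1 (M i u - M' i u) := by
  induction n using Fin.induction with
  | zero => simp [l1]
  | succ k ih =>
    have hsplit : marginal M ν k.succ - marginal M' ν k.succ =
        marginal M ν k.castSucc ᵥ* (M k - M' k) +
          (marginal M ν k.castSucc - marginal M' ν k.castSucc) ᵥ* M' k := by
      rw [marginal_succ, marginal_succ, Matrix.vecMul_sub, Matrix.sub_vecMul]
      abel
    have hcontract : l1 ((marginal M ν k.castSucc - marginal M' ν k.castSucc) ᵥ* M' k) ≤
        l1 (marginal M ν k.castSucc - marginal M' ν k.castSucc) :=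
      (l1_vecMul_le _ _).trans
        (Finset.sum_le_sum fun u _ => mul_le_of_le_one_right (abs_nonneg _) (hM' k u))
    have hfilter : (Finset.univ.filter fun i : Fin N => i.castSucc < k.succ) =
        insert k (Finset.univ.filter fun i : Fin N => i.castSucc < k.castSucc) := by
      ext i
      simp [Fin.castSucc_lt_succ_iff, le_iff_eq_or_lt]
    rw [hsplit, hfilter, Finset.sum_insert (by simp)]
    exact (l1_add_le _ _).trans (add_le_add (l1_vecMul_le _ _) (hcontract.trans ih))

end Chain

/-! ### Occupancy measures -/

section Occupancy

variable {X A : Type*} {N : ℕ} {p q : Kernel X A N} {π : Policy X A N} {ν : X × A → ℝ}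

/-- Every row of `p` is a subprobability on states. Estimated kernels are only subkernels: their
rows at unvisited pairs vanish. -/
def IsSubKernel [Fintype X] (p : Kernel X A N) : Prop := 0 ≤ p ∧ ∀ n y, ∑ x, p n y x ≤ 1

lemma IsKernel.nonneg [Fintype X] (hp : IsKernel p) : 0 ≤ p := fun n y => (hp n y).1

lemma IsKernel.isSubKernel [Fintype X] (hp : IsKernel p) : IsSubKernel p :=
  ⟨hp.nonneg, fun n y => (hp n y).2.le⟩

lemma IsSubKernel.l1_le_one [Fintype X] (hp : IsSubKernel p) (n : Fin N) (y : X × A) :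
    l1 (p n y) ≤ 1 :=
  (l1_eq_sum_of_nonneg (hp.1 n y)).trans_le (hp.2 n y)

lemma stepMatrix_sub (p q : Kernel X A N) (π : Policy X A N) (n : Fin N) :
    stepMatrix (p - q) π n = stepMatrix p π n - stepMatrix q π n := by
  ext y z
  exact sub_mul _ _ _

lemma stepMatrix_nonneg [Fintype A] (hp : 0 ≤ p) (hπ : IsPolicy π) (n : Fin N) (y z : X × A) :
    0 ≤ stepMatrix p π n y z :=
  mul_nonneg (hp n y z.1) ((hπ n z.1).1 z.2)

variable [Fintype X] [Fintype A]

lemma sum_stepMatrix_mul (p : Kernel X A N) (hπ : IsPolicy π) (n : Fin N) (y : X × A)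
    (G : X → ℝ) : ∑ z, stepMatrix p π n y z * G z.1 = ∑ x, p n y x * G x := by
  rw [Fintype.sum_prod_type]
  refine Finset.sum_congr rfl fun x _ => ?_
  simp only [stepMatrix, Matrix.of_apply, mul_right_comm _ _ (G x), ← Finset.mul_sum, (hπ n x).2,
    mul_one]

lemma stepMatrix_mem_stdSimplex (hp : IsKernel p) (hπ : IsPolicy π) (n : Fin N) (y : X × A) :
    stepMatrix p π n y ∈ stdSimplex ℝ (X × A) :=
  ⟨stepMatrix_nonneg hp.nonneg hπ n y, by
    simpa only [mul_one, (hp n y).2] using sum_stepMatrix_mul p hπ n y fun _ => 1⟩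

lemma l1_stepMatrix (p : Kernel X A N) (hπ : IsPolicy π) (n : Fin N) (y : X × A) :
    l1 (stepMatrix p π n y) = l1 (p n y) := by
  have habs : ∀ z : X × A,
      |stepMatrix p π n y z| = stepMatrix (fun n y x => |p n y x|) π n y z := fun z => by
    simp only [stepMatrix, Matrix.of_apply, abs_mul, abs_of_nonneg ((hπ n z.1).1 z.2)]
  simpa only [l1, habs, mul_one] using
    sum_stepMatrix_mul (fun n y x => |p n y x|) hπ n y fun _ => 1

lemma occ_eq_marginal (p : Kernel X A N) (π : Policy X A N) (ν : X × A → ℝ) :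
    occ p π ν = marginal (stepMatrix p π) ν := rfl

lemma occ_nonneg (hp : 0 ≤ p) (hπ : IsPolicy π) (hν : 0 ≤ ν) : 0 ≤ occ p π ν :=
  marginal_nonneg (stepMatrix_nonneg hp hπ) hν

lemma occ_mem_stdSimplex (hp : IsKernel p) (hπ : IsPolicy π) (hν : ν ∈ stdSimplex ℝ (X × A))
    (n : Fin (N + 1)) : occ p π ν n ∈ stdSimplex ℝ (X × A) :=
  marginal_mem_stdSimplex (stepMatrix_mem_stdSimplex hp hπ) hν n

lemma occ_mem_flowSet (hp : 0 ≤ p) (hπ : IsPolicy π) (hν : 0 ≤ ν) :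
    occ p π ν ∈ flowSet p ν := by
  refine ⟨occ_nonneg hp hπ hν, rfl, fun n x => ?_⟩
  have hrow : ∀ a, occ p π ν n.succ (x, a) =
      (∑ y, occ p π ν n.castSucc y * p n y x) * π n x a := fun a => by
    rw [Finset.sum_mul]
    exact Finset.sum_congr rfl fun y _ => (mul_assoc _ _ _).symm
  simp only [hrow, ← Finset.mul_sum, (hπ n x).2, mul_one]

lemma l1_occ_sub_occ_le (hp : 0 ≤ p) (hq : IsSubKernel q) (hπ : IsPolicy π) (hν : 0 ≤ ν)
    (n : Fin (N + 1)) :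
    l1 (occ p π ν n - occ q π ν n) ≤ pairBonus (occ p π ν) fun i y => l1 (p i y - q i y) := by
  have hstep : ∀ i y, l1 (stepMatrix p π i y - stepMatrix q π i y) = l1 (p i y - q i y) :=
    fun i y => by
      rw [← Pi.sub_apply (p i), ← Pi.sub_apply p, ← l1_stepMatrix (p - q) hπ, stepMatrix_sub]
      rfl
  calc l1 (occ p π ν n - occ q π ν n)
      ≤ ∑ i : Fin N with i.castSucc < n, ∑ y, |occ p π ν i.castSucc y| * l1 (p i y - q i y) := by
        simpa only [hstep, ← occ_eq_marginal] using l1_marginal_sub_marginal_le (stepMatrix p π)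
          (fun i y => (l1_stepMatrix q hπ i y).trans_le (hq.l1_le_one i y)) ν n
    _ ≤ ∑ i : Fin N, ∑ y, |occ p π ν i.castSucc y| * l1 (p i y - q i y) :=
        Finset.sum_le_sum_of_subset_of_nonneg (Finset.filter_subset _ _) fun i _ _ =>
          Finset.sum_nonneg fun y _ => mul_nonneg (abs_nonneg _) (l1_nonneg _)
    _ = pairBonus (occ p π ν) fun i y => l1 (p i y - q i y) := by
        simp only [abs_of_nonneg (occ_nonneg hp hπ hν _ _), pairBonus]

lemma pairBonus_mono {μ : Occ X A N} (hμ : 0 ≤ μ) : Monotone (pairBonus μ) := fun _ _ hb =>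
  Finset.sum_le_sum fun n _ => Finset.sum_le_sum fun y _ =>
    mul_le_mul_of_nonneg_left (hb n y) (hμ _ y)

lemma pairBonus_nonneg {μ : Occ X A N} (hμ : 0 ≤ μ) {b : Fin N → X × A → ℝ} (hb : 0 ≤ b) :
    0 ≤ pairBonus μ b :=
  Finset.sum_nonneg fun n _ => Finset.sum_nonneg fun y _ => mul_nonneg (hμ _ y) (hb n y)

lemma l1_occ_sub_occ_le_pairBonus (hp : 0 ≤ p) (hq : IsSubKernel q) (hπ : IsPolicy π)
    (hν : 0 ≤ ν) {b : Fin N → X × A → ℝ} (hb : ∀ n y, l1 (p n y - q n y) ≤ b n y)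
    (n : Fin (N + 1)) : l1 (occ p π ν n - occ q π ν n) ≤ pairBonus (occ p π ν) b :=
  (l1_occ_sub_occ_le hp hq hπ hν n).trans (pairBonus_mono (occ_nonneg hp hπ hν) hb)

lemma pairBonus_occ_le (hp : 0 ≤ p) (hq : IsSubKernel q) (hπ : IsPolicy π) (hν : 0 ≤ ν)
    {b : Fin N → X × A → ℝ} (hb : ∀ n y, l1 (p n y - q n y) ≤ b n y) {B : ℝ}
    (hbB : ∀ n y, b n y ≤ B) (hB : 0 ≤ B) :
    pairBonus (occ q π ν) b ≤ (1 + N * B) * pairBonus (occ p π ν) b := by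
  have habs : ∀ n y, |b n y| ≤ B := fun n y =>
    (abs_of_nonneg ((l1_nonneg _).trans (hb n y))).trans_le (hbB n y)
  calc pairBonus (occ q π ν) b
      ≤ ∑ n : Fin N, (∑ y, occ p π ν n.castSucc y * b n y + B * pairBonus (occ p π ν) b) := by
        refine Finset.sum_le_sum fun n _ => ?_
        refine (sum_mul_le_sum_mul_add_mul_l1_sub _ (occ p π ν n.castSucc) (habs n)).trans ?_
        rw [l1_sub_comm]
        gcongr
        exact l1_occ_sub_occ_le_pairBonus hp hq hπ hν hb _
    _ = (1 + N * B) * pairBonus (occ p π ν) b := by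
        rw [Finset.sum_add_distrib, ← pairBonus, Fin.sum_const, nsmul_eq_mul]
        ring

end Occupancy

section InitDist

variable {X A : Type*} [Fintype X] [Fintype A] [DecidableEq X] [DecidableEq A] {N : ℕ}
  {p : Kernel X A N} {ρ : X × A → ℝ}

/-- The occupancy measure of episode `t` under the true kernel, the counterpart of `estOcc`. -/
def trueOcc (p : Kernel X A N) (ρ : X × A → ℝ) (π : ℕ → Policy X A N) (t : ℕ) : Occ X A N :=
  occ p (π t) (initDist p ρ π t)

lemma vecMul_partialMatrix (p : Kernel X A N) (π : Policy X A N) (ν : X × A → ℝ)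
    (n : Fin (N + 1)) : ν ᵥ* partialMatrix p π n = occ p π ν n := by
  induction n using Fin.induction with
  | zero => exact Matrix.vecMul_one ν
  | succ i ih =>
    rw [occ_eq_marginal, marginal_succ, ← occ_eq_marginal, ← ih, Matrix.vecMul_vecMul]
    rfl

lemma vecMul_episodeMatrix (p : Kernel X A N) (π : Policy X A N) (ν : X × A → ℝ) :
    ν ᵥ* episodeMatrix p π = occ p π ν (Fin.last N) :=
  vecMul_partialMatrix p π ν _

lemma initDist_succ (p : Kernel X A N) (ρ : X × A → ℝ) (π : ℕ → Policy X A N) (t : ℕ) :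
    initDist p ρ π (t + 1) = trueOcc p ρ π t (Fin.last N) :=
  vecMul_episodeMatrix p (π t) _

lemma initDist_mem_stdSimplex (hp : IsKernel p) (hρ : ρ ∈ stdSimplex ℝ (X × A))
    {π : ℕ → Policy X A N} {t : ℕ} (hπ : ∀ s < t, IsPolicy (π s)) :
    initDist p ρ π t ∈ stdSimplex ℝ (X × A) := by
  induction t with
  | zero => exact hρ
  | succ t ih =>
    rw [initDist_succ]
    exact occ_mem_stdSimplex hp (hπ t t.lt_succ_self)
      (ih fun s hs => hπ s (hs.trans t.lt_succ_self)) _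

lemma trueOcc_mem_stdSimplex (hp : IsKernel p) (hρ : ρ ∈ stdSimplex ℝ (X × A))
    {π : ℕ → Policy X A N} {t : ℕ} (hπ : ∀ s ≤ t, IsPolicy (π s)) (n : Fin (N + 1)) :
    trueOcc p ρ π t n ∈ stdSimplex ℝ (X × A) :=
  occ_mem_stdSimplex hp (hπ t le_rfl) (initDist_mem_stdSimplex hp hρ fun s hs => hπ s hs.le) n

end InitDist

/-! ### Counts and estimated kernels -/

section Counts

lemma inv_sqrt_max_le (m : ℕ) : 1 / √(max 1 (m : ℝ)) ≤ 3 * √((m : ℝ) + 1) - 3 * √m := by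
  rcases Nat.eq_zero_or_pos m with rfl | hm
  · norm_num
  have hm1 : (1 : ℝ) ≤ m := Nat.one_le_cast.2 hm
  have hsqrt : √((m : ℝ) + 1) ≤ 2 * √m := by
    rw [Real.sqrt_le_left (by positivity), mul_pow, Real.sq_sqrt (by positivity)]
    linarith
  have hmul : (√((m : ℝ) + 1) - √m) * (√((m : ℝ) + 1) + √m) = 1 := by
    rw [mul_comm, ← sq_sub_sq, Real.sq_sqrt (by positivity), Real.sq_sqrt (by positivity)]
    ring
  have hdiff : 0 ≤ √((m : ℝ) + 1) - √m := sub_nonneg.2 (Real.sqrt_le_sqrt (by linarith))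
  rw [max_eq_right hm1, div_le_iff₀ (Real.sqrt_pos.2 (by positivity))]
  nlinarith

lemma sum_inv_sqrt_count_le {S : Type*} [Fintype S] [DecidableEq S] (u : ℕ → S) (T : ℕ) :
    ∑ t ∈ Finset.range T, 1 / √(max 1 (Nat.count (u · = u t) t : ℝ)) ≤
      3 * √((Fintype.card S : ℝ) * T) := by
  have hpotential : ∑ t ∈ Finset.range T, 1 / √(max 1 (Nat.count (u · = u t) t : ℝ)) ≤
      3 * ∑ y, √(Nat.count (u · = y) T) := by
    induction T with
    | zero => simp
    | succ T ih =>
      have hincr : 3 * ∑ y, √(Nat.count (u · = y) (T + 1)) - 3 * ∑ y, √(Nat.count (u · = y) T) =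
          3 * √(Nat.count (u · = u T) T + 1) - 3 * √(Nat.count (u · = u T) T) := by
        rw [← mul_sub, ← mul_sub, ← Finset.sum_sub_distrib, Finset.sum_eq_single (u T)]
        · simp [Nat.count_succ]
        · intro y _ hy
          simp [Nat.count_succ, hy.symm]
        · simp
      rw [Finset.sum_range_succ]
      linarith [inv_sqrt_max_le (Nat.count (u · = u T) T)]
  have htotal : ∑ y, (Nat.count (u · = y) T : ℝ) = T := by
    simp only [Nat.count_eq_card_filter_range, ← Finset.sum_boole]
    rw [Finset.sum_comm]
    simp
  refine hpotential.trans
    (mul_le_mul_of_nonneg_left (Real.le_sqrt_of_sq_le (sq_sum_le_card_mul_sum_sq.trans_eq ?_))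
      (by norm_num))
  simp [Real.sq_sqrt, htotal]

variable {X A : Type*} {N : ℕ} [DecidableEq X] [DecidableEq A]

lemma visits_eq_count (o : ℕ → Traj X A N) (t : ℕ) (n : Fin N) (y : X × A) :
    visits o t n y = Nat.count (fun s => o s n.castSucc = y) t :=
  (Nat.count_eq_card_filter_range _ _).symm

lemma visits_le (o : ℕ → Traj X A N) (t : ℕ) (n : Fin N) (y : X × A) : visits o t n y ≤ t :=
  (visits_eq_count o t n y).trans_le (Nat.count_le _)

lemma moves_le_visits (o : ℕ → Traj X A N) (t : ℕ) (n : Fin N) (y : X × A) (x : X) :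
    moves o t n y x ≤ visits o t n y :=
  Finset.card_le_card (Finset.monotone_filter_right _ fun _ _ h => h.1)

lemma sum_inv_sqrt_visits_le [Fintype X] [Fintype A] (o : ℕ → Traj X A N) (T : ℕ) (n : Fin N) :
    ∑ t ∈ Finset.range T, 1 / √(max 1 (visits o t n (o t n.castSucc) : ℝ)) ≤
      3 * √((Fintype.card X : ℝ) * Fintype.card A * T) := by
  simpa only [visits_eq_count, Fintype.card_prod, Nat.cast_mul] using
    sum_inv_sqrt_count_le (fun t => o t n.castSucc) T

variable [Fintype X]

lemma sum_moves_mul (o : ℕ → Traj X A N) (t : ℕ) (n : Fin N) (y : X × A) (s : X → ℝ) :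
    ∑ x, (moves o t n y x : ℝ) * s x =
      ∑ r ∈ Finset.range t, if o r n.castSucc = y then s (o r n.succ).1 else 0 := by
  simp only [moves, Finset.card_filter, Nat.cast_sum, Finset.sum_mul]
  rw [Finset.sum_comm]
  refine Finset.sum_congr rfl fun r _ => ?_
  by_cases h : o r n.castSucc = y <;> simp [h]

lemma sum_moves (o : ℕ → Traj X A N) (t : ℕ) (n : Fin N) (y : X × A) :
    ∑ x, (moves o t n y x : ℝ) = visits o t n y := by
  rw [visits, ← Finset.sum_boole]
  simpa only [mul_one] using sum_moves_mul o t n y fun _ => 1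

lemma isSubKernel_estKernel (o : ℕ → Traj X A N) (t : ℕ) : IsSubKernel (estKernel o t) := by
  refine ⟨fun n y x => ?_, fun n y => ?_⟩ <;> unfold estKernel <;> split_ifs
  · positivity
  · positivity
  · simpa using mul_inv_le_one
  · rw [← Finset.sum_div, sum_moves]
    exact div_le_one_of_le₀ (le_max_right _ _) (by positivity)

variable [Fintype A]

lemma bonus_nonneg (T : ℕ) (δ : ℝ) (o : ℕ → Traj X A N) (t : ℕ) : 0 ≤ bonus T δ o t :=
  fun _ _ => div_nonneg (Real.sqrt_nonneg _) (Real.sqrt_nonneg _)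

lemma bonus_le (T : ℕ) (δ : ℝ) (o : ℕ → Traj X A N) (t : ℕ) (n : Fin N) (y : X × A) :
    bonus T δ o t n y ≤ bonusConst X A N T δ :=
  div_le_self (Real.sqrt_nonneg _) (Real.one_le_sqrt.2 (le_max_left _ _))

end Counts

/-! ### The recursion for the distance to the periodic distribution -/

section Recursion

lemma sum_succ_le_of_le_mul_add {α : ℝ} (hα : 0 ≤ α) {d c : ℕ → ℝ} {T : ℕ} (hd0 : d 0 = 0)
    (hdT : 0 ≤ d T) (h : ∀ t < T, d (t + 1) ≤ α * d t + c t) :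
    (1 - α) * ∑ t ∈ Finset.range T, d (t + 1) ≤ ∑ t ∈ Finset.range T, c t := by
  have hsum : ∑ t ∈ Finset.range T, d (t + 1) ≤ ∑ t ∈ Finset.range T, (α * d t + c t) :=
    Finset.sum_le_sum fun t ht => h t (Finset.mem_range.1 ht)
  have hshift : ∑ t ∈ Finset.range T, d t ≤ ∑ t ∈ Finset.range T, d (t + 1) := by
    have := (Finset.sum_range_succ d T).symm.trans (Finset.sum_range_succ' d T)
    linarith
  rw [Finset.sum_add_distrib, ← Finset.mul_sum] at hsum
  linarith [mul_le_mul_of_nonneg_left hshift hα]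

variable {X A : Type*} [Fintype X] [Fintype A] [DecidableEq X] [DecidableEq A] {N T t : ℕ}
  {p : Kernel X A N} {ρ : X × A → ℝ} {α δ : ℝ} {o : ℕ → Traj X A N} {π : ℕ → Policy X A N}

/-- Before episode `t`, every row of the estimated kernel is within its bonus of the true row. -/
def IsAccurate (p : Kernel X A N) (T : ℕ) (δ : ℝ) (o : ℕ → Traj X A N) (t : ℕ) : Prop :=
  ∀ n y, l1 (estKernel o t n y - p n y) ≤ bonus T δ o t n y

lemma feasibleSet_nonempty (hp : IsKernel p) (hρ : ρ ∈ stdSimplex ℝ (X × A))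
    (hfeas : ∃ π : Policy X A N, IsPeriodic p ρ π) (hcontr : PeriodicContraction p ρ α)
    (hν : initDist p ρ π t ∈ stdSimplex ℝ (X × A)) (hacc : IsAccurate p T δ o t) :
    (feasibleSet p ρ T δ α o π t).Nonempty := by
  obtain ⟨π₀, hπ₀, hfix⟩ := hfeas
  have hdrift := hcontr π₀ ⟨hπ₀, hfix⟩ _ hν ρ hρ
  rw [hfix, vecMul_episodeMatrix] at hdrift
  have hq := isSubKernel_estKernel o t
  refine ⟨occ (estKernel o t) π₀ (initDist p ρ π t), occ_mem_flowSet hq.1 hπ₀ hν.1, ?_⟩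
  exact (l1_sub_le _ (occ p π₀ (initDist p ρ π t) (Fin.last N)) _).trans
    (add_le_add (l1_occ_sub_occ_le_pairBonus hq.1 hp.isSubKernel hπ₀ hν.1 hacc _) hdrift)

lemma l1_initDist_succ_sub_le (hp : IsKernel p) (hπ : IsPolicy (π t))
    (hν : initDist p ρ π t ∈ stdSimplex ℝ (X × A)) (hacc : IsAccurate p T δ o t)
    (hmem : estOcc p ρ o π t ∈ feasibleSet p ρ T δ α o π t) :
    l1 (initDist p ρ π (t + 1) - ρ) ≤ α * l1 (initDist p ρ π t - ρ) +
      2 * (1 + N * bonusConst X A N T δ) * pairBonus (trueOcc p ρ π t) (bonus T δ o t) := by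
  have hq := isSubKernel_estKernel o t
  have htrue_est : l1 (initDist p ρ π (t + 1) - estOcc p ρ o π t (Fin.last N)) ≤
      pairBonus (estOcc p ρ o π t) (bonus T δ o t) := by
    rw [initDist_succ, l1_sub_comm]
    exact l1_occ_sub_occ_le_pairBonus hq.1 hp.isSubKernel hπ hν.1 hacc _
  have hest : pairBonus (estOcc p ρ o π t) (bonus T δ o t) ≤
      (1 + N * bonusConst X A N T δ) * pairBonus (trueOcc p ρ π t) (bonus T δ o t) :=
    pairBonus_occ_le hp.nonneg hq hπ hν.1 (fun n y => (l1_sub_comm _ _).trans_le (hacc n y))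
      (bonus_le T δ o t) (Real.sqrt_nonneg _)
  linarith [l1_sub_le (initDist p ρ π (t + 1)) (estOcc p ρ o π t (Fin.last N)) ρ, hmem.2]

lemma sum_l1_initDist_sub_le (hp : IsKernel p) (hρ : ρ ∈ stdSimplex ℝ (X × A)) (hα : 0 ≤ α)
    (hfeas : ∃ π : Policy X A N, IsPeriodic p ρ π) (hcontr : PeriodicContraction p ρ α)
    (hπ : ∀ t < T, IsPolicy (π t)) (hacc : ∀ t < T, t ≠ 0 → IsAccurate p T δ o t)
    (hupd : ∀ t, t + 1 < T → (feasibleSet p ρ T δ α o π (t + 1)).Nonempty →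
      estOcc p ρ o π (t + 1) ∈ feasibleSet p ρ T δ α o π (t + 1)) :
    (1 - α) * ∑ t ∈ Finset.range T, l1 (initDist p ρ π (t + 1) - ρ) ≤
      2 + 2 * (1 + N * bonusConst X A N T δ) *
        ∑ t ∈ Finset.range T, pairBonus (trueOcc p ρ π t) (bonus T δ o t) := by
  have hmem : ∀ t ≤ T, initDist p ρ π t ∈ stdSimplex ℝ (X × A) := fun t ht =>
    initDist_mem_stdSimplex hp hρ fun s hs => hπ s (hs.trans_le ht)
  have hK : 0 ≤ 2 * (1 + N * bonusConst X A N T δ) := by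
    have : 0 ≤ bonusConst X A N T δ := Real.sqrt_nonneg _
    positivity
  have hstep : ∀ t < T, l1 (initDist p ρ π (t + 1) - ρ) ≤ α * l1 (initDist p ρ π t - ρ) +
      ((if t = 0 then 2 else 0) + 2 * (1 + N * bonusConst X A N T δ) *
        pairBonus (trueOcc p ρ π t) (bonus T δ o t)) := by
    rintro (_ | t) ht
    · have hbonus : 0 ≤ pairBonus (trueOcc p ρ π 0) (bonus T δ o 0) :=
        pairBonus_nonneg (occ_nonneg hp.nonneg (hπ 0 ht) (hmem 0 ht.le).1) (bonus_nonneg T δ o 0)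
      rw [if_pos rfl]
      linarith [l1_sub_le_two (hmem 1 ht) hρ, mul_nonneg hK hbonus,
        mul_nonneg hα (l1_nonneg (initDist p ρ π 0 - ρ))]
    · have hν := hmem (t + 1) ht.le
      have hacc := hacc (t + 1) ht t.succ_ne_zero
      simpa using l1_initDist_succ_sub_le hp (hπ _ ht) hν hacc
        (hupd t ht (feasibleSet_nonempty hp hρ hfeas hcontr hν hacc))
  have hfirst : ∑ t ∈ Finset.range T, (if t = 0 then (2 : ℝ) else 0) ≤ 2 := by
    rw [Finset.sum_ite_eq']
    split_ifs <;> norm_num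
  have hrec := sum_succ_le_of_le_mul_add (d := fun t => l1 (initDist p ρ π t - ρ)) hα
    (l1_sub_self ρ) (l1_nonneg _) hstep
  rw [Finset.sum_add_distrib, ← Finset.mul_sum] at hrec
  linarith

end Recursion

/-! ### Conditional expectations and exponential supermartingales -/

section CondExp

variable {Ω : Type*} {m mΩ : MeasurableSpace Ω} {P : Measure Ω}

lemma condExp_select {J : Type*} [Finite J] {σ : Ω → J} (hσ : ∀ j, MeasurableSet[m] {ω | σ ω = j})
    {f : J → Ω → ℝ} (hf : ∀ j, Integrable (f j) P) (hm : m ≤ mΩ) :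
    P[fun ω => f (σ ω) ω | m] =ᵐ[P] fun ω => (P[f (σ ω) | m]) ω := by
  classical
  cases nonempty_fintype J
  have hsplit : ∀ g : J → Ω → ℝ,
      (fun ω => g (σ ω) ω) = ∑ j, {ω | σ ω = j}.indicator (g j) := fun g => by
    ext ω
    simp [Finset.sum_apply, Set.indicator_apply]
  have hind : ∀ᵐ ω ∂P, ∀ j, (P[{ω | σ ω = j}.indicator (f j) | m]) ω =
      {ω | σ ω = j}.indicator (P[f j | m]) ω :=
    ae_all_iff.2 fun j => condExp_indicator (hf j) (hσ j)
  rw [hsplit f, hsplit fun j => P[f j | m]]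
  refine (condExp_finsetSum (fun j _ => (hf j).indicator (hm _ (hσ j))) m).trans ?_
  filter_upwards [hind] with ω hω
  simp only [Finset.sum_apply, hω]

variable {S : Type*}

lemma measurable_comp [Countable S] {o : Ω → S} (ho : ∀ z, MeasurableSet[m] {ω | o ω = z})
    {F : Ω → S → ℝ} (hF : ∀ z, Measurable[m] fun ω => F ω z) :
    Measurable[m] fun ω => F ω (o ω) := by
  intro s hs
  have hsplit : (fun ω => F ω (o ω)) ⁻¹' s = ⋃ z, {ω | o ω = z} ∩ (fun ω => F ω z) ⁻¹' s := by
    ext ω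
    simp
  rw [hsplit]
  exact .iUnion fun z => (ho z).inter (hF z hs)

variable [Fintype S]

lemma condExp_comp {o : Ω → S} (ho : ∀ z, MeasurableSet {ω | o ω = z}) {q : Ω → S → ℝ}
    (hq : ∀ z, P⟦{ω | o ω = z} | m⟧ =ᵐ[P] fun ω => q ω z) {F : Ω → S → ℝ}
    (hF : ∀ z, StronglyMeasurable[m] fun ω => F ω z) (hint : Integrable (fun ω => F ω (o ω)) P)
    [IsFiniteMeasure P] :
    P[fun ω => F ω (o ω) | m] =ᵐ[P] fun ω => ∑ z, F ω z * q ω z := by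
  classical
  have hone : ∀ z, Integrable ({ω | o ω = z}.indicator fun _ => (1 : ℝ)) P := fun z =>
    (integrable_const 1).indicator (ho z)
  have hmul : ∀ z, Integrable
      ((fun ω => F ω z) * {ω | o ω = z}.indicator fun _ => (1 : ℝ)) P := fun z => by
    refine (hint.indicator (ho z)).congr (.of_forall fun ω => ?_)
    by_cases h : o ω = z <;> simp [h]
  have hsplit : (fun ω => F ω (o ω)) =
      ∑ z, (fun ω => F ω z) * {ω | o ω = z}.indicator fun _ => (1 : ℝ) := by
    ext ω
    simp [Finset.sum_apply, Set.indicator_apply]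
  have hpull : ∀ᵐ ω ∂P, ∀ z,
      (P[(fun ω => F ω z) * {ω | o ω = z}.indicator fun _ => (1 : ℝ) | m]) ω =
        F ω z * (P⟦{ω | o ω = z} | m⟧) ω :=
    ae_all_iff.2 fun z => condExp_mul_of_stronglyMeasurable_left (hF z) (hmul z) (hone z)
  rw [hsplit]
  refine (condExp_finsetSum (fun z _ => hmul z) m).trans ?_
  filter_upwards [hpull, ae_all_iff.2 hq] with ω hω hqω
  simp only [Finset.sum_apply, hω, hqω]

lemma sum_ite_mul_prod {R J : Type*} [CommSemiring R] [Fintype J] [DecidableEq J] [DecidableEq S]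
    {κ : J → S → R} (hκ : ∀ j, ∑ z, κ j z = 1) (j : J) (z : S) :
    ∑ w : J → S, (if w j = z then 1 else 0) * ∏ i, κ i (w i) = κ j z := by
  have hprod : ∀ w : J → S, (if w j = z then 1 else 0) * ∏ i, κ i (w i) =
      ∏ i, if i = j then (if w i = z then 1 else 0) * κ i (w i) else κ i (w i) := fun w => by
    rw [← Finset.mul_prod_erase _ _ (Finset.mem_univ j), ← mul_assoc,
      ← Finset.mul_prod_erase _ _ (Finset.mem_univ j), if_pos rfl]
    congr 1
    exact Finset.prod_congr rfl fun i hi => (if_neg (Finset.ne_of_mem_erase hi)).symm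
  rw [Finset.sum_congr rfl fun w _ => hprod w,
    ← Fintype.prod_sum (fun i s => if i = j then (if s = z then 1 else 0) * κ i s else κ i s),
    Finset.prod_eq_single j]
  · simp
  · intro i _ hi
    simp [hi, hκ]
  · simp

lemma condProb_of_pi [IsFiniteMeasure P] {J : Type*} [Fintype J] {W : J → Ω → S}
    (hW : ∀ j z, MeasurableSet {ω | W j ω = z}) {κ : J → Ω → S → ℝ}
    (hκ : ∀ j ω, ∑ z, κ j ω z = 1)
    (hjoint : ∀ w : J → S, P⟦{ω | ∀ j, W j ω = w j} | m⟧ =ᵐ[P] fun ω => ∏ j, κ j ω (w j))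
    (j : J) (z : S) : P⟦{ω | W j ω = z} | m⟧ =ᵐ[P] fun ω => κ j ω z := by
  classical
  have hind : ({ω | W j ω = z}.indicator fun _ => (1 : ℝ)) =
      fun ω => if (fun i => W i ω) j = z then 1 else 0 := by
    ext ω
    simp [Set.indicator_apply]
  have hjoint' : ∀ w : J → S, P⟦{ω | (fun j => W j ω) = w} | m⟧ =ᵐ[P]
      fun ω => ∏ j, κ j ω (w j) := by
    simpa only [funext_iff] using hjoint
  have hmeas : ∀ w : J → S, MeasurableSet {ω | (fun j => W j ω) = w} := fun w => by
    simpa only [funext_iff, Set.ofPred_forall] using MeasurableSet.iInter fun j => hW j (w j)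
  have hint := (integrable_const (μ := P) (1 : ℝ)).indicator (hW j z)
  rw [hind] at hint ⊢
  refine (condExp_comp hmeas hjoint' (F := fun _ w => if w j = z then 1 else 0)
    (fun _ => stronglyMeasurable_const) hint).trans (.of_forall fun ω => ?_)
  exact sum_ite_mul_prod (fun i => hκ i ω) j z

end CondExp

section Supermartingale

variable {Ω : Type*} {mΩ : MeasurableSpace Ω} {P : Measure Ω}

lemma integrable_exp_of_le [IsFiniteMeasure P] {D : Ω → ℝ} (hD : StronglyMeasurable D) {B : ℝ}
    (hB : ∀ ω, D ω ≤ B) : Integrable (fun ω => Real.exp (D ω)) P := by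
  refine .of_bound (Real.continuous_exp.comp_stronglyMeasurable hD).aestronglyMeasurable
    (Real.exp B) (.of_forall fun ω => ?_)
  rw [Real.norm_of_nonneg (Real.exp_pos _).le]
  exact Real.exp_le_exp.2 (hB ω)

variable {ℱ : Filtration ℕ mΩ} {T : ℕ} {D : ℕ → Ω → ℝ}

lemma integrable_exp_sum [IsFiniteMeasure P]
    (hD : ∀ t < T, StronglyMeasurable[ℱ (t + 1)] (D t)) {B : ℝ}
    (hB : ∀ t < T, ∀ ω, D t ω ≤ B) :
    Integrable (fun ω => Real.exp (∑ t ∈ Finset.range T, D t ω)) P :=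
  integrable_exp_of_le
    (Finset.stronglyMeasurable_fun_sum _ fun t ht =>
      (hD t (Finset.mem_range.1 ht)).mono (ℱ.le _))
    fun ω => Finset.sum_le_sum fun t ht => hB t (Finset.mem_range.1 ht) ω

variable [IsProbabilityMeasure P]

lemma integral_exp_sum_le_one (hD : ∀ t < T, StronglyMeasurable[ℱ (t + 1)] (D t)) {B : ℝ}
    (hB : ∀ t < T, ∀ ω, D t ω ≤ B)
    (hexp : ∀ t < T, P[fun ω => Real.exp (D t ω) | ℱ t] ≤ᵐ[P] 1) :
    ∫ ω, Real.exp (∑ t ∈ Finset.range T, D t ω) ∂P ≤ 1 := by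
  induction T with
  | zero => simp
  | succ T ih =>
    have hD' : ∀ t < T, StronglyMeasurable[ℱ (t + 1)] (D t) := fun t ht => hD t (by lia)
    have hB' : ∀ t < T, ∀ ω, D t ω ≤ B := fun t ht => hB t (by lia)
    have hpast : StronglyMeasurable[ℱ T] fun ω => Real.exp (∑ t ∈ Finset.range T, D t ω) :=
      Real.continuous_exp.comp_stronglyMeasurable <| Finset.stronglyMeasurable_fun_sum _
        fun t ht => (hD' t (Finset.mem_range.1 ht)).mono (ℱ.mono (Finset.mem_range.1 ht))
    have hlast : Integrable (fun ω => Real.exp (D T ω)) P :=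
      integrable_exp_of_le ((hD T T.lt_succ_self).mono (ℱ.le _)) (hB T T.lt_succ_self)
    have hprod : (fun ω => Real.exp (∑ t ∈ Finset.range (T + 1), D t ω)) =
        (fun ω => Real.exp (∑ t ∈ Finset.range T, D t ω)) * fun ω => Real.exp (D T ω) := by
      ext ω
      rw [Finset.sum_range_succ, Real.exp_add, Pi.mul_apply]
    have hint := integrable_exp_sum (P := P) hD hB
    rw [← integral_condExp (ℱ.le T)]
    refine (integral_mono_ae integrable_condExp (integrable_exp_sum hD' hB') ?_).trans
      (ih hD' hB' fun t ht => hexp t (by lia))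
    rw [hprod] at hint ⊢
    filter_upwards [condExp_mul_of_stronglyMeasurable_left hpast hint hlast,
      hexp T T.lt_succ_self] with ω hpull hle
    rw [hpull]
    exact mul_le_of_le_one_right (Real.exp_pos _).le hle

lemma measureReal_le_sum_le_exp_neg (hD : ∀ t < T, StronglyMeasurable[ℱ (t + 1)] (D t)) {B : ℝ}
    (hB : ∀ t < T, ∀ ω, D t ω ≤ B)
    (hexp : ∀ t < T, P[fun ω => Real.exp (D t ω) | ℱ t] ≤ᵐ[P] 1) (c : ℝ) :
    P.real {ω | c ≤ ∑ t ∈ Finset.range T, D t ω} ≤ Real.exp (-c) := by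
  have hmarkov := measure_ge_le_exp_mul_mgf (X := fun ω => ∑ t ∈ Finset.range T, D t ω) c
    zero_le_one (by simpa only [one_mul] using integrable_exp_sum (P := P) hD hB)
  simp only [mgf, one_mul, neg_mul] at hmarkov
  exact hmarkov.trans
    (mul_le_of_le_one_right (Real.exp_pos _).le (integral_exp_sum_le_one hD hB hexp))

end Supermartingale

lemma sum_mul_exp_sub_le_one {S : Type*} [Fintype S] {w : S → ℝ} (hw : w ∈ stdSimplex ℝ S)
    {v : S → ℝ} {a b : ℝ} (hv : ∀ i, v i ∈ Set.Icc a b) (θ : ℝ) :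
    ∑ i, w i * Real.exp (θ * (v i - ∑ j, w j * v j) - (b - a) ^ 2 / 8 * θ ^ 2) ≤ 1 := by
  let _ : MeasurableSpace S := ⊤
  have hsum : ∑ i, ENNReal.ofReal (w i) = 1 := by
    rw [← ENNReal.ofReal_sum_of_nonneg fun i _ => hw.1 i, hw.2, ENNReal.ofReal_one]
  let μ := PMF.ofFintype (fun i => ENNReal.ofReal (w i)) hsum
  have hint : ∀ f : S → ℝ, ∫ i, f i ∂μ.toMeasure = ∑ i, w i * f i := fun f => by
    rw [PMF.integral_eq_sum]
    refine Finset.sum_congr rfl fun i _ => ?_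
    rw [PMF.ofFintype_apply, ENNReal.toReal_ofReal (hw.1 i), smul_eq_mul]
  have hhoeffding := (hasSubgaussianMGF_of_mem_Icc (μ := μ.toMeasure) (X := v)
    measurable_from_top.aemeasurable (.of_forall hv)).mgf_le θ
  have hvar : (((‖b - a‖₊ / 2) ^ 2 : NNReal) : ℝ) * θ ^ 2 / 2 = (b - a) ^ 2 / 8 * θ ^ 2 := by
    push_cast
    rw [div_pow, Real.norm_eq_abs, sq_abs]
    ring
  rw [mgf, hint, hint, hvar] at hhoeffding
  simp only [Real.exp_sub, ← mul_div_assoc, ← Finset.sum_div]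
  exact div_le_one_of_le₀ hhoeffding (Real.exp_pos _).le

/-! ### The law of the observed trajectories -/

section PathProb

variable {X A : Type*} {N : ℕ} {p : Kernel X A N}

lemma sum_ite_mul_pathProb [Fintype X] [Fintype A] [DecidableEq X] [DecidableEq A]
    (hp : IsKernel p) {π : Policy X A N} (hπ : IsPolicy π) (y : X × A) :
    ∑ z : Traj X A N, (if y = z 0 then 1 else 0) * pathProb p π z = 1 := by
  calc ∑ z : Traj X A N, (if y = z 0 then 1 else 0) * pathProb p π z
      = ∑ u, marginal (stepMatrix p π) (fun u => if y = u then 1 else 0) (Fin.last N) u := by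
        simpa only [mul_one, pathProb] using
          sum_path_mul_last (stepMatrix p π) (fun u => if y = u then 1 else 0) fun _ => 1
    _ = ∑ u, if y = u then 1 else 0 :=
        sum_marginal_eq_of_le _ (Fin.zero_le _) fun n _ u => (stepMatrix_mem_stdSimplex hp hπ n u).2
    _ = 1 := by simp

end PathProb

section Measurability

variable {X A Ω : Type*} {N : ℕ} {mΩ : MeasurableSpace Ω}

lemma measurable_pathProb (p : Kernel X A N) {π : Ω → Policy X A N} (hπ : Measurable π)
    (z : Traj X A N) : Measurable fun ω => pathProb p (π ω) z :=
  Finset.measurable_prod _ fun n _ => measurable_const.mul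
    (by fun_prop : Measurable fun ω => π ω n (z n.succ).1 (z n.succ).2)

lemma measurable_visits [Finite X] [Finite A] [DecidableEq X] [DecidableEq A]
    {o : Ω → ℕ → Traj X A N} {t : ℕ} (ho : ∀ s < t, ∀ z, MeasurableSet {ω | o ω s = z})
    (n : Fin N) (y : X × A) : Measurable fun ω => visits (o ω) t n y := by
  simp only [visits, Finset.card_filter]
  refine Finset.measurable_sum _ fun s hs => Measurable.ite ?_ measurable_const measurable_const
  have hsplit : {ω | o ω s n.castSucc = y} =
      ⋃ z ∈ {z : Traj X A N | z n.castSucc = y}, {ω | o ω s = z} := by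
    ext ω
    simp
  rw [hsplit]
  exact .biUnion (Set.to_countable _) fun z _ => ho s (Finset.mem_range.1 hs) z

variable [Fintype X] [Fintype A]

lemma measurable_occ (p : Kernel X A N) {π : Ω → Policy X A N} (hπ : Measurable π)
    {ν : Ω → X × A → ℝ} (hν : Measurable ν) (n : Fin (N + 1)) :
    Measurable fun ω => occ p (π ω) (ν ω) n := by
  induction n using Fin.induction with
  | zero => exact hν
  | succ i ih =>
    refine measurable_pi_iff.2 fun y => Finset.measurable_sum _ fun u _ => ?_
    exact (measurable_pi_iff.1 ih u).mul
      (measurable_const.mul (by fun_prop : Measurable fun ω => π ω i y.1 y.2))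

lemma measurable_initDist [DecidableEq X] [DecidableEq A] (p : Kernel X A N) (ρ : X × A → ℝ)
    {π : ℕ → Ω → Policy X A N} {t : ℕ} (hπ : ∀ s < t, Measurable (π s)) :
    Measurable fun ω => initDist p ρ (fun s => π s ω) t := by
  induction t with
  | zero => exact measurable_const
  | succ t ih =>
    simp only [initDist_succ]
    exact measurable_occ p (hπ t t.lt_succ_self) (ih fun s hs => hπ s (hs.trans t.lt_succ_self)) _

end Measurability

section Observation

variable {X A Ω : Type*} [Fintype X] [Fintype A] [DecidableEq X] [DecidableEq A] {N : ℕ}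
  {mΩ : MeasurableSpace Ω}

/-- The online learning problem as the learner sees it: given its information `ℱ t`, the
trajectory `o ω t` observed in episode `t` follows `p` and the current policy, from the initial
distribution `initDist`. The agents behind the observations do not appear. -/
structure IsObservationProcess (P : Measure Ω) (p : Kernel X A N) (ρ : X × A → ℝ) (T : ℕ)
    (ℱ : Filtration ℕ mΩ) (o : Ω → ℕ → Traj X A N) (π : ℕ → Ω → Policy X A N) : Prop where
  observed_meas : ∀ t ≤ T, ∀ s < t, ∀ z : Traj X A N, MeasurableSet[ℱ t] {ω | o ω s = z}
  policy : ∀ t < T, ∀ ω, IsPolicy (π t ω)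
  policy_meas : ∀ t < T, Measurable[ℱ t] (π t)
  condProb : ∀ t < T, ∀ z : Traj X A N,
    P⟦{ω | o ω t = z} | ℱ t⟧ =ᵐ[P]
      fun ω => initDist p ρ (fun s => π s ω) t (z 0) * pathProb p (π t ω) z

variable {J : Type*} [Fintype J] {P : Measure Ω} {p : Kernel X A N} {ρ : X × A → ℝ}
  {T : ℕ} {ℱ 𝒢 : Filtration ℕ mΩ} {Z : ℕ → J → Ω → Traj X A N} {sel : ℕ → Ω → J}
  {π : ℕ → Ω → Policy X A N} {t : ℕ}

lemma IsProtocol.measurableSet_agent (hprot : IsProtocol P p ρ T ℱ 𝒢 Z sel π) (ht : t < T)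
    (j : J) (z : Traj X A N) : MeasurableSet {ω | Z t j ω = z} :=
  𝒢.le (t + 1) _ (hprot.past_meas (t + 1) ht t t.lt_succ_self j z)

variable [IsProbabilityMeasure P]

lemma IsProtocol.condProb_agent (hprot : IsProtocol P p ρ T ℱ 𝒢 Z sel π) (hp : IsKernel p)
    (ht : t < T) (j : J) (z : Traj X A N) :
    P⟦{ω | Z t j ω = z} | 𝒢 t⟧ =ᵐ[P]
      fun ω => (if Z t j ω 0 = z 0 then 1 else 0) * pathProb p (π t ω) z := by
  classical
  refine condProb_of_pi (hprot.measurableSet_agent ht)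
    (κ := fun j ω z => (if Z t j ω 0 = z 0 then 1 else 0) * pathProb p (π t ω) z)
    (fun j ω => sum_ite_mul_pathProb hp (hprot.policy t ht ω) _)
    (fun w => (hprot.move t ht w).trans (.of_forall fun ω => ?_)) j z
  simp only [Finset.prod_mul_distrib]
  simp [Set.indicator_apply, Finset.prod_boole]

lemma IsProtocol.condProb_observed (hprot : IsProtocol P p ρ T ℱ 𝒢 Z sel π) (hp : IsKernel p)
    (ht : t < T) (z : Traj X A N) :
    P⟦{ω | observed Z sel ω t = z} | 𝒢 t⟧ =ᵐ[P]
      fun ω => (if observed Z sel ω t 0 = z 0 then 1 else 0) * pathProb p (π t ω) z := by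
  have hint : ∀ j, Integrable ({ω | Z t j ω = z}.indicator fun _ => (1 : ℝ)) P := fun j =>
    (integrable_const 1).indicator (hprot.measurableSet_agent ht j z)
  filter_upwards [condExp_select (hprot.sel_meas t ht) hint (𝒢.le t),
    ae_all_iff.2 fun j => hprot.condProb_agent hp ht j z] with ω hselect hagent
  exact hselect.trans (hagent (sel t ω))

lemma IsProtocol.isObservationProcess (hprot : IsProtocol P p ρ T ℱ 𝒢 Z sel π)
    (hp : IsKernel p) : IsObservationProcess P p ρ T ℱ (observed Z sel) π where
  observed_meas := hprot.observed_meas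
  policy := hprot.policy
  policy_meas := hprot.policy_meas
  condProb t ht z := by
    have hstart : MeasurableSet {ω | observed Z sel ω t 0 = z 0} := by
      have hsplit : {ω | observed Z sel ω t 0 = z 0} =
          ⋃ j, {ω | sel t ω = j} ∩ {ω | Z t j ω 0 = z 0} := by
        ext ω
        simp [observed]
      rw [hsplit]
      exact .iUnion fun j => 𝒢.le t _ ((hprot.sel_meas t ht j).inter (hprot.start_meas t ht j _))
    have hfactor :
        (fun ω => (if observed Z sel ω t 0 = z 0 then 1 else 0) * pathProb p (π t ω) z) =
          (fun ω => pathProb p (π t ω) z) *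
            {ω | observed Z sel ω t 0 = z 0}.indicator fun _ => 1 := by
      ext ω
      by_cases h : observed Z sel ω t 0 = z 0 <;> simp [h]
    have hcond := hprot.condProb_observed hp ht z
    have hint := integrable_condExp.congr hcond
    rw [hfactor] at hcond hint
    refine (condExp_condExp_of_le (hprot.info_le t ht.le) (𝒢.le t)).symm.trans
      ((condExp_congr_ae hcond).trans ?_)
    have hpath : StronglyMeasurable[ℱ t] fun ω => pathProb p (π t ω) z :=
      (measurable_pathProb p (hprot.policy_meas t ht) z).stronglyMeasurable
    filter_upwards [condExp_mul_of_stronglyMeasurable_left hpath hint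
      ((integrable_const 1).indicator hstart), hprot.indep t ht (z 0)] with ω hpull hindep
    rw [hpull, Pi.mul_apply, mul_comm]
    exact congrArg (· * _) hindep

end Observation

/-! ### Concentration of the observations -/

section Concentration

variable {X A : Type*} [DecidableEq X] [DecidableEq A] {N : ℕ}

lemma sum_mul_le_of_mem_stdSimplex {S : Type*} [Fintype S] {w f : S → ℝ}
    (hw : w ∈ stdSimplex ℝ S) {c : ℝ} (hf : ∀ i, f i ≤ c) : ∑ i, w i * f i ≤ c := by
  calc ∑ i, w i * f i ≤ ∑ i, w i * c :=
        Finset.sum_le_sum fun i _ => mul_le_mul_of_nonneg_left (hf i) (hw.1 i)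
    _ = c := by rw [← Finset.sum_mul, hw.2, one_mul]

lemma count_and_count_lt (q : ℕ → Prop) [DecidablePred q] (m T : ℕ) :
    Nat.count (fun r => q r ∧ Nat.count q r < m) T = min (Nat.count q T) m := by
  induction T with
  | zero => simp
  | succ T ih =>
    rw [Nat.count_succ, Nat.count_succ, ih]
    split_ifs <;> lia

lemma sum_ite_visits_lt_le (o : ℕ → Traj X A N) (T : ℕ) (n : Fin N) (y : X × A) (m : ℕ) :
    ∑ r ∈ Finset.range T, (if o r n.castSucc = y ∧ visits o r n y < m then (1 : ℝ) else 0) ≤ m := by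
  have hcount := count_and_count_lt (fun r => o r n.castSucc = y) m T
  rw [Nat.count_eq_card_filter_range] at hcount
  simp only [visits_eq_count, Finset.sum_boole, hcount]
  exact_mod_cast min_le_right _ _

/-- The sum, over the first `m` visits of `y` at time step `n`, of the deviation of `s` at the
next state from its mean under `p`. Visits from episode `T` on are disregarded. -/
def centredVisitSum [Fintype X] (p : Kernel X A N) (o : ℕ → Traj X A N) (T : ℕ) (n : Fin N)
    (y : X × A) (m : ℕ) (s : X → ℝ) : ℝ :=
  ∑ r ∈ Finset.range T,
    if o r n.castSucc = y ∧ visits o r n y < m then s (o r n.succ).1 - ∑ x, p n y x * s x else 0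

variable [Fintype X] [Fintype A] {Ω : Type*} {mΩ : MeasurableSpace Ω} {P : Measure Ω}
  {p : Kernel X A N} {ρ : X × A → ℝ} {T : ℕ} {ℱ : Filtration ℕ mΩ} {o : Ω → ℕ → Traj X A N}
  {π : ℕ → Ω → Policy X A N}

lemma IsObservationProcess.measurable_trueOcc (hobs : IsObservationProcess P p ρ T ℱ o π) {t : ℕ}
    (ht : t < T) (n : Fin (N + 1)) :
    Measurable[ℱ t] fun ω => trueOcc p ρ (fun s => π s ω) t n :=
  measurable_occ p (hobs.policy_meas t ht) (measurable_initDist p ρ fun s hs =>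
    (hobs.policy_meas s (hs.trans ht)).mono (ℱ.mono hs.le) le_rfl) n

variable [IsProbabilityMeasure P]

lemma IsObservationProcess.condExp_step (hobs : IsObservationProcess P p ρ T ℱ o π)
    (hp : IsKernel p) {t : ℕ} (ht : t < T) (n : Fin N) {F : Ω → X × A → X × A → ℝ}
    (hF : ∀ u v, StronglyMeasurable[ℱ t] fun ω => F ω u v)
    (hint : Integrable (fun ω => F ω (o ω t n.castSucc) (o ω t n.succ)) P) :
    P[fun ω => F ω (o ω t n.castSucc) (o ω t n.succ) | ℱ t] =ᵐ[P] fun ω =>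
      ∑ u, trueOcc p ρ (fun s => π s ω) t n.castSucc u *
        ∑ v, stepMatrix p (π t ω) n u v * F ω u v := by
  refine (condExp_comp (fun z => ℱ.le _ _ (hobs.observed_meas (t + 1) ht t t.lt_succ_self z))
    (hobs.condProb t ht) (F := fun ω z => F ω (z n.castSucc) (z n.succ)) (fun z => hF _ _)
    hint).trans (.of_forall fun ω => ?_)
  simp only [mul_comm (F ω _ _)]
  exact sum_path_mul_step
    (fun i u => (stepMatrix_mem_stdSimplex hp (hobs.policy t ht ω) i u).2)
    (initDist p ρ (fun s => π s ω) t) n (F ω)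

/-- `V t` is a predictable variance proxy of `Y t`: this is what `hexp` expresses. -/
lemma IsObservationProcess.measureReal_le_sum_le (hobs : IsObservationProcess P p ρ T ℱ o π)
    (hp : IsKernel p) (n : Fin N) {Y : ℕ → Ω → X × A → X × A → ℝ} {V : ℕ → Ω → X × A → ℝ}
    (hYm : ∀ t < T, ∀ u v, Measurable[ℱ t] fun ω => Y t ω u v)
    (hVm : ∀ t < T, ∀ u, Measurable[ℱ t] fun ω => V t ω u)
    {B : ℝ} (hYB : ∀ t < T, ∀ ω u v, Y t ω u v ≤ B) (hV0 : ∀ t < T, ∀ ω u, 0 ≤ V t ω u)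
    {K : ℝ} (hVK : ∀ ω, ∑ t ∈ Finset.range T, V t ω (o ω t n.castSucc) ≤ K)
    (hexp : ∀ t < T, ∀ ω θ, ∑ u, trueOcc p ρ (fun s => π s ω) t n.castSucc u *
      ∑ v, stepMatrix p (π t ω) n u v * Real.exp (θ * Y t ω u v - V t ω u / 2 * θ ^ 2) ≤ 1)
    {x : ℝ} (hx : 0 ≤ x) :
    P.real {ω | x ≤ ∑ t ∈ Finset.range T, Y t ω (o ω t n.castSucc) (o ω t n.succ)} ≤
      Real.exp (-(x ^ 2 / (2 * K))) := by
  have hK : Ω → 0 ≤ K := fun ω =>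
    (Finset.sum_nonneg fun t ht => hV0 t (Finset.mem_range.1 ht) ω _).trans (hVK ω)
  set θ := x / K
  have hoptimal : θ * x - K / 2 * θ ^ 2 = x ^ 2 / (2 * K) := by
    rcases eq_or_ne K 0 with hK0 | hK0
    · simp [θ, hK0]
    · simp only [θ]
      field_simp
      ring
  let D t ω u v := θ * Y t ω u v - V t ω u / 2 * θ ^ 2
  have hDm : ∀ t < T, ∀ u v, Measurable[ℱ t] fun ω => D t ω u v := fun t ht u v =>
    ((hYm t ht u v).const_mul θ).sub (((hVm t ht u).div_const 2).mul_const _)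
  have hDB : ∀ t < T, ∀ ω u v, D t ω u v ≤ θ * B := fun t ht ω u v =>
    (sub_le_self _ (by have := hV0 t ht ω u; positivity)).trans
      (mul_le_mul_of_nonneg_left (hYB t ht ω u v) (div_nonneg hx (hK ω)))
  have hDo : ∀ t < T,
      StronglyMeasurable[ℱ (t + 1)] fun ω => D t ω (o ω t n.castSucc) (o ω t n.succ) :=
    fun t ht => (measurable_comp (hobs.observed_meas (t + 1) ht t t.lt_succ_self)
      (F := fun ω z => D t ω (z n.castSucc) (z n.succ))
      fun z => (hDm t ht _ _).mono (ℱ.mono t.le_succ) le_rfl).stronglyMeasurable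
  refine (measureReal_mono fun ω hω => ?_).trans
    (measureReal_le_sum_le_exp_neg hDo (fun t ht ω => hDB t ht ω _ _) (fun t ht => ?_) _)
  · simp only [Set.mem_ofPred_eq, D, Finset.sum_sub_distrib, ← Finset.mul_sum, ← Finset.sum_mul,
      ← Finset.sum_div, ← hoptimal] at hω ⊢
    have := hVK ω
    gcongr
    exact div_nonneg hx (hK ω)
  · filter_upwards [hobs.condExp_step hp ht n
      (F := fun ω u v => Real.exp (D t ω u v))
      (fun u v => Real.continuous_exp.comp_stronglyMeasurable (hDm t ht u v).stronglyMeasurable)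
      (integrable_exp_of_le ((hDo t ht).mono (ℱ.le _)) fun ω => hDB t ht ω _ _)] with ω hω
    exact hω.trans_le (hexp t ht ω θ)

lemma IsObservationProcess.measureReal_le_centredVisitSum_le
    (hobs : IsObservationProcess P p ρ T ℱ o π) (hp : IsKernel p) (hρ : ρ ∈ stdSimplex ℝ (X × A))
    (n : Fin N) (y : X × A) (m : ℕ) {s : X → ℝ} (hs : ∀ x, s x ∈ Set.Icc (-1) 1)
    {x : ℝ} (hx : 0 ≤ x) :
    P.real {ω | x ≤ centredVisitSum p (o ω) T n y m s} ≤ Real.exp (-(x ^ 2 / (2 * m))) := by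
  have hactive : ∀ t < T, ∀ u, MeasurableSet[ℱ t] {ω | u = y ∧ visits (o ω) t n y < m} :=
    fun t ht u => (MeasurableSet.const _).inter
      (measurable_visits (hobs.observed_meas t ht.le) n y measurableSet_Iio)
  refine hobs.measureReal_le_sum_le hp n
    (Y := fun t ω u v => if u = y ∧ visits (o ω) t n y < m then s v.1 - ∑ x, p n y x * s x else 0)
    (V := fun t ω u => if u = y ∧ visits (o ω) t n y < m then 1 else 0)
    (fun t ht u v => .ite (hactive t ht u) measurable_const measurable_const)
    (fun t ht u => .ite (hactive t ht u) measurable_const measurable_const)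
    (B := |1 - ∑ x, p n y x * s x|) (fun t _ ω u v => ?_) (fun t _ ω u => ?_)
    (fun ω => sum_ite_visits_lt_le (o ω) T n y m) (fun t ht ω θ => ?_) hx
  · split_ifs
    · exact (sub_le_sub_right (hs _).2 _).trans (le_abs_self _)
    · exact abs_nonneg _
  · split_ifs <;> norm_num
  · have hπ := fun r (hr : r ≤ t) => hobs.policy r (hr.trans_lt ht) ω
    refine sum_mul_le_of_mem_stdSimplex (trueOcc_mem_stdSimplex hp hρ hπ _) fun u => ?_
    by_cases h : u = y ∧ visits (o ω) t n y < m
    · obtain rfl := h.1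
      have hlt := h.2
      simp only [hlt, and_self, if_true]
      rw [sum_stepMatrix_mul p (hπ t le_rfl) n u fun x =>
        Real.exp (θ * (s x - ∑ x, p n u x * s x) - 1 / 2 * θ ^ 2)]
      convert sum_mul_exp_sub_le_one (hp n u) hs θ using 6
      norm_num
    · simp [if_neg h, (stepMatrix_mem_stdSimplex hp (hπ t le_rfl) n u).2]

lemma IsObservationProcess.measureReal_le_sum_mean_sub_le
    (hobs : IsObservationProcess P p ρ T ℱ o π) (hp : IsKernel p) (hρ : ρ ∈ stdSimplex ℝ (X × A))
    (n : Fin N) {g : ℕ → Ω → X × A → ℝ} (hgm : ∀ t < T, ∀ y, Measurable[ℱ t] fun ω => g t ω y)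
    {C : ℝ} (hg : ∀ t < T, ∀ ω y, g t ω y ∈ Set.Icc 0 C) {x : ℝ} (hx : 0 ≤ x) :
    P.real {ω | x ≤ ∑ t ∈ Finset.range T,
        (∑ y, trueOcc p ρ (fun s => π s ω) t n.castSucc y * g t ω y - g t ω (o ω t n.castSucc))} ≤
      Real.exp (-(x ^ 2 / (2 * (T * (C ^ 2 / 4))))) := by
  have hocc : ∀ t < T, ∀ ω, trueOcc p ρ (fun s => π s ω) t n.castSucc ∈ stdSimplex ℝ (X × A) :=
    fun t ht ω => trueOcc_mem_stdSimplex hp hρ (fun r hr => hobs.policy r (hr.trans_lt ht) ω) _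
  have hmean : ∀ t < T, Measurable[ℱ t] fun ω =>
      ∑ y, trueOcc p ρ (fun s => π s ω) t n.castSucc y * g t ω y := fun t ht =>
    Finset.measurable_sum _ fun y _ =>
      ((measurable_pi_apply y).comp (hobs.measurable_trueOcc ht _)).mul (hgm t ht y)
  refine hobs.measureReal_le_sum_le hp n (V := fun _ _ _ => C ^ 2 / 4)
    (Y := fun t ω u _ => ∑ y, trueOcc p ρ (fun s => π s ω) t n.castSucc y * g t ω y - g t ω u)
    (fun t ht u _ => (hmean t ht).sub (hgm t ht u)) (fun _ _ _ => measurable_const)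
    (B := C) (fun t ht ω u _ => ?_) (fun _ _ _ _ => by positivity) (fun _ => by simp)
    (fun t ht ω θ => ?_) hx
  · have := sum_mul_le_of_mem_stdSimplex (hocc t ht ω) fun y => (hg t ht ω y).2
    linarith [(hg t ht ω u).1]
  · simp only [← Finset.sum_mul, (stepMatrix_mem_stdSimplex hp (hobs.policy t ht ω) n _).2, one_mul]
    convert sum_mul_exp_sub_le_one (hocc t ht ω) (hg t ht ω) (-θ) using 5
    all_goals ring

end Concentration

/-! ### The good events -/

section GoodEvents

lemma two_pow_mul_exp_le {k : ℕ} (hk : 1 ≤ k) {K δ : ℝ} (hδ : 0 < δ) (hK : 2 * δ ≤ K) :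
    2 ^ k * K * Real.exp (-(k * Real.log (K / δ))) ≤ 2 * δ := by
  obtain ⟨j, rfl⟩ := Nat.exists_eq_add_of_le' hk
  have hK0 : 0 < K := by linarith
  calc 2 ^ (j + 1) * K * Real.exp (-((j + 1 : ℕ) * Real.log (K / δ)))
      = 2 * δ * (2 * δ / K) ^ j := by
        rw [Real.exp_neg, Real.exp_nat_mul, Real.exp_log (by positivity), div_pow, div_pow, mul_pow]
        field_simp
        ring
    _ ≤ 2 * δ := mul_le_of_le_one_right (by positivity)
        (pow_le_one₀ (by positivity) ((div_le_one hK0).2 hK))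

variable {X A : Type*} [Fintype X] [DecidableEq X] [DecidableEq A] {N : ℕ}

lemma moves_eq_visits_mul_estKernel (o : ℕ → Traj X A N) {t : ℕ} (ht : t ≠ 0) (n : Fin N)
    (y : X × A) (x : X) : (moves o t n y x : ℝ) = visits o t n y * estKernel o t n y x := by
  rw [estKernel, if_neg ht]
  rcases Nat.eq_zero_or_pos (visits o t n y) with hv | hv
  · simp [hv, Nat.le_zero.1 ((moves_le_visits o t n y x).trans_eq hv)]
  · rw [max_eq_right (Nat.one_le_cast.2 hv)]
    field_simp

lemma centredVisitSum_visits (p : Kernel X A N) (o : ℕ → Traj X A N) {T t : ℕ} (ht : t ≠ 0)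
    (htT : t ≤ T) (n : Fin N) (y : X × A) (s : X → ℝ) :
    centredVisitSum p o T n y (visits o t n y) s =
      visits o t n y * ∑ x, (estKernel o t n y - p n y) x * s x := by
  have hbefore : ∀ r, (o r n.castSucc = y ∧ visits o r n y < visits o t n y) ↔
      (r < t ∧ o r n.castSucc = y) := fun r => by
    simp only [visits_eq_count]
    exact ⟨fun h => ⟨Nat.lt_of_count_lt_count h.2, h.1⟩,
      fun h => ⟨h.2, Nat.count_strict_mono h.2 h.1⟩⟩
  calc centredVisitSum p o T n y (visits o t n y) s
      = ∑ r ∈ Finset.range t,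
          if o r n.castSucc = y then s (o r n.succ).1 - ∑ x, p n y x * s x else 0 := by
        simp only [centredVisitSum, hbefore]
        refine (Finset.sum_subset_zero_on_sdiff (Finset.range_mono htT) (fun r hr => ?_)
          fun r hr => ?_).symm
        · exact if_neg fun h => (Finset.mem_sdiff.1 hr).2 (Finset.mem_range.2 h.1)
        · simp [Finset.mem_range.1 hr]
    _ = ∑ x, (moves o t n y x : ℝ) * (s x - ∑ x, p n y x * s x) :=
        (sum_moves_mul o t n y fun x => s x - ∑ x, p n y x * s x).symm
    _ = visits o t n y * ∑ x, (estKernel o t n y - p n y) x * s x := by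
        simp only [mul_sub, Finset.sum_sub_distrib, ← Finset.sum_mul, sum_moves, Pi.sub_apply,
          sub_mul]
        simp only [moves_eq_visits_mul_estKernel o ht, mul_assoc, Finset.mul_sum]

variable [Fintype A]

lemma exists_units_le_centredVisitSum {p : Kernel X A N} (hp : IsKernel p) {T : ℕ} {δ : ℝ}
    (hC : 1 ≤ bonusConst X A N T δ) (o : ℕ → Traj X A N) {t : ℕ} (ht : t ≠ 0) (htT : t ≤ T)
    {n : Fin N} {y : X × A} (h : bonus T δ o t n y < l1 (estKernel o t n y - p n y)) :
    0 < visits o t n y ∧ ∃ s : X → ℤˣ, √(visits o t n y) * bonusConst X A N T δ ≤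
      centredVisitSum p o T n y (visits o t n y) fun x => (s x : ℤ) := by
  have hpos : 0 < visits o t n y := by
    rw [Nat.pos_iff_ne_zero]
    intro hv
    have hzero : estKernel o t n y = 0 := by
      funext x
      simp [estKernel, ht, Nat.le_zero.1 ((moves_le_visits o t n y x).trans_eq hv)]
    rw [hzero, l1_sub_comm, sub_zero, l1_of_mem_stdSimplex (hp n y), bonus, hv] at h
    norm_num at h
    linarith
  obtain ⟨s, hs⟩ := exists_units_sum_mul_eq_l1 (estKernel o t n y - p n y)
  refine ⟨hpos, s, ?_⟩
  rw [centredVisitSum_visits p o ht htT, hs]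
  rw [bonus, max_eq_right (Nat.one_le_cast.2 hpos)] at h
  calc √(visits o t n y) * bonusConst X A N T δ
      = visits o t n y * (bonusConst X A N T δ / √(visits o t n y)) := by
        rw [mul_div_left_comm, Real.div_sqrt, mul_comm]
    _ ≤ visits o t n y * l1 (estKernel o t n y - p n y) := by gcongr

variable {Ω : Type*} {mΩ : MeasurableSpace Ω} {P : Measure Ω} [IsProbabilityMeasure P]
  {p : Kernel X A N} {ρ : X × A → ℝ} {T : ℕ} {ℱ : Filtration ℕ mΩ} {o : Ω → ℕ → Traj X A N}
  {π : ℕ → Ω → Policy X A N} {δ : ℝ}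

lemma IsObservationProcess.measureReal_not_isAccurate_le
    (hobs : IsObservationProcess P p ρ T ℱ o π) (hp : IsKernel p) (hρ : ρ ∈ stdSimplex ℝ (X × A))
    (hC : 1 ≤ bonusConst X A N T δ) :
    P.real {ω | ∃ t < T, t ≠ 0 ∧ ¬ IsAccurate p T δ (o ω) t} ≤
      2 ^ Fintype.card X * ((Fintype.card X : ℝ) * Fintype.card A * N * T) *
        Real.exp (-(bonusConst X A N T δ ^ 2 / 2)) := by
  set C := bonusConst X A N T δ
  let B : (X → ℤˣ) × Fin N × (X × A) × Fin T → Set Ω := fun ⟨s, n, y, k⟩ =>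
    {ω | √((k + 1 : ℕ) : ℝ) * C ≤ centredVisitSum p (o ω) T n y (k + 1) fun x => (s x : ℤ)}
  have hB : ∀ i, P.real (B i) ≤ Real.exp (-(C ^ 2 / 2)) := fun ⟨s, n, y, k⟩ => by
    have hs : ∀ x, ((s x : ℤ) : ℝ) ∈ Set.Icc (-1) 1 := fun x => by
      rcases Int.units_eq_one_or (s x) with h | h <;> simp [h]
    refine (hobs.measureReal_le_centredVisitSum_le hp hρ n y (k + 1) hs (by positivity)).trans_eq ?_
    rw [mul_pow, Real.sq_sqrt (Nat.cast_nonneg _), mul_comm 2, mul_div_mul_left]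
    positivity
  calc P.real {ω | ∃ t < T, t ≠ 0 ∧ ¬ IsAccurate p T δ (o ω) t} ≤ P.real (⋃ i, B i) := by
        refine measureReal_mono fun ω hω => ?_
        obtain ⟨t, htT, ht, hacc⟩ := hω
        simp only [IsAccurate, not_forall, not_le] at hacc
        obtain ⟨n, y, hlt⟩ := hacc
        obtain ⟨hpos, s, hs⟩ := exists_units_le_centredVisitSum hp hC (o ω) ht htT.le hlt
        obtain ⟨k, hk⟩ := Nat.exists_eq_add_one.2 hpos
        have hkT : k < T := by
          have := visits_le (o ω) t n y
          lia
        exact Set.mem_iUnion.2 ⟨(s, n, y, ⟨k, hkT⟩), by rwa [hk] at hs⟩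
    _ ≤ ∑ _, Real.exp (-(C ^ 2 / 2)) :=
        (measureReal_iUnion_fintype_le B).trans (Finset.sum_le_sum fun i _ => hB i)
    _ = _ := by
        simp only [Finset.sum_const, Finset.card_univ, Fintype.card_prod, Fintype.card_fun,
          Fintype.card_units_int, Fintype.card_fin, nsmul_eq_mul]
        push_cast
        ring

lemma IsObservationProcess.measureReal_sum_bonus_lt_le
    (hobs : IsObservationProcess P p ρ T ℱ o π) (hp : IsKernel p) (hρ : ρ ∈ stdSimplex ℝ (X × A))
    (hN : 0 < N) (hT : 0 < T) (hδ0 : 0 < δ) (hδN : δ ≤ N) (hC : 1 ≤ bonusConst X A N T δ) :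
    P.real {ω | ∃ n, ∑ t ∈ Finset.range T, bonus T δ (o ω) t n (o ω t n.castSucc) +
        bonusConst X A N T δ * √(T * Real.log (N / δ) / 2) <
      ∑ t ∈ Finset.range T,
        ∑ y, trueOcc p ρ (fun s => π s ω) t n.castSucc y * bonus T δ (o ω) t n y} ≤ δ := by
  set C := bonusConst X A N T δ
  set x := C * √(T * Real.log (N / δ) / 2)
  let B : Fin N → Set Ω := fun n => {ω | x ≤ ∑ t ∈ Finset.range T,
    (∑ y, trueOcc p ρ (fun s => π s ω) t n.castSucc y * bonus T δ (o ω) t n y -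
      bonus T δ (o ω) t n (o ω t n.castSucc))}
  have hlog : 0 ≤ Real.log (N / δ) := Real.log_nonneg ((one_le_div hδ0).2 hδN)
  have hexponent : x ^ 2 / (2 * (T * (C ^ 2 / 4))) = Real.log (N / δ) := by
    rw [mul_pow, Real.sq_sqrt (by positivity)]
    field_simp
    norm_num
  have hB : ∀ n, P.real (B n) ≤ δ / N := fun n => by
    refine (hobs.measureReal_le_sum_mean_sub_le hp hρ n (C := C) (x := x)
      (g := fun t ω y => bonus T δ (o ω) t n y) (fun t ht y => ?_)
      (fun t _ ω y => ⟨bonus_nonneg T δ (o ω) t n y, bonus_le T δ (o ω) t n y⟩)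
      (by positivity)).trans_eq ?_
    · exact (measurable_from_nat (f := fun v : ℕ => C / √(max 1 (v : ℝ)))).comp
        (measurable_visits (hobs.observed_meas t ht.le) n y)
    · rw [hexponent, ← Real.log_inv, inv_div, Real.exp_log (by positivity)]
  calc P.real {ω | ∃ n, _ < _} ≤ P.real (⋃ n, B n) := by
        refine measureReal_mono fun ω hω => ?_
        obtain ⟨n, hn⟩ := hω
        refine Set.mem_iUnion.2 ⟨n, ?_⟩
        simp only [B, Set.mem_ofPred_eq, Finset.sum_sub_distrib]
        linarith
    _ ≤ ∑ _, δ / N := (measureReal_iUnion_fintype_le B).trans (Finset.sum_le_sum fun n _ => hB n)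
    _ = δ := by
        rw [Finset.sum_const, Finset.card_univ, Fintype.card_fin, nsmul_eq_mul]
        field_simp

end GoodEvents

/-! ### The numerical estimate -/

section Numerics

lemma one_le_log_div {u δ : ℝ} (hu : 1 ≤ u) (hδ0 : 0 < δ) (hδ : δ ≤ 1 / 3) :
    1 ≤ Real.log (u / δ) := by
  rw [Real.le_log_iff_exp_le (by positivity), le_div_iff₀ hδ0]
  nlinarith [Real.exp_one_lt_three]

lemma one_add_mul_mul_le {N y C : ℝ} (hN : 1 ≤ N) (hy : 1 ≤ y) (hC0 : 0 ≤ C)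
    (hC : C ^ 2 = 2 * y) : (1 + N * C) * (N * C) ≤ 7 / 2 * (N ^ 2 * y) := by
  have hCy : C ≤ 3 / 2 * y := abs_le_of_sq_le_sq' (by nlinarith) (by positivity) |>.2
  calc (1 + N * C) * (N * C) = N * C + N ^ 2 * C ^ 2 := by ring
    _ ≤ N ^ 2 * (3 / 2 * y) + N ^ 2 * (2 * y) := by
        rw [hC]
        gcongr
        exact le_self_pow₀ hN two_ne_zero
    _ = 7 / 2 * (N ^ 2 * y) := by ring

lemma three_mul_sqrt_add_sqrt_le {x S T G : ℝ} (hx : 1 ≤ x) (hS : 0 ≤ S) (hTS : T ≤ S)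
    (hG : 1 ≤ G) : 3 * √(x * S) + √(T * G / 2) ≤ 4 * √(x * S * G) := by
  have hfirst : √(x * S) ≤ √(x * S * G) :=
    Real.sqrt_le_sqrt (le_mul_of_one_le_right (by positivity) hG)
  have hsecond : √(T * G / 2) ≤ √(x * S * G) := Real.sqrt_le_sqrt <| by
    nlinarith [mul_le_mul_of_nonneg_right (hTS.trans (le_mul_of_one_le_left hS hx))
      (zero_le_one.trans hG), mul_nonneg (mul_nonneg (zero_le_one.trans hx) hS)
      (zero_le_one.trans hG)]
  linarith

lemma two_add_two_mul_le_thirty_mul {N x a T L G C : ℝ} (hN : 1 ≤ N) (hx : 1 ≤ x) (ha : 1 ≤ a)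
    (hT : 1 ≤ T) (hL : 1 ≤ L) (hG : 1 ≤ G) (hC0 : 0 ≤ C) (hC : C ^ 2 = 2 * (x * L)) :
    2 + 2 * (1 + N * C) * (N * (C * (3 * √(x * a * T) + √(T * G / 2)))) ≤
      30 * N ^ 2 * x ^ (3 / 2 : ℝ) * √(a * T) * L * √G := by
  have hxL : 1 ≤ x * L := one_le_mul_of_one_le_of_one_le hx hL
  have hroot : 1 ≤ √(x * (a * T) * G) := Real.one_le_sqrt.2 <|
    one_le_mul_of_one_le_of_one_le (one_le_mul_of_one_le_of_one_le hx
      (one_le_mul_of_one_le_of_one_le ha hT)) hG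
  have hone : 1 ≤ N ^ 2 * (x * L) * √(x * (a * T) * G) :=
    one_le_mul_of_one_le_of_one_le (one_le_mul_of_one_le_of_one_le (one_le_pow₀ hN) hxL) hroot
  have hx32 : x ^ (3 / 2 : ℝ) = x * √x := by
    rw [Real.sqrt_eq_rpow, ← Real.rpow_one_add' (by linarith) (by norm_num)]
    norm_num
  have hprod : (1 + N * C) * (N * C) * (3 * √(x * (a * T)) + √(T * G / 2)) ≤
      7 / 2 * (N ^ 2 * (x * L)) * (4 * √(x * (a * T) * G)) :=
    mul_le_mul (one_add_mul_mul_le hN hxL hC0 hC)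
      (three_mul_sqrt_add_sqrt_le hx (by positivity) (le_mul_of_one_le_left (by positivity) ha) hG)
      (by positivity) (by positivity)
  calc 2 + 2 * (1 + N * C) * (N * (C * (3 * √(x * a * T) + √(T * G / 2))))
      = 2 + 2 * ((1 + N * C) * (N * C) * (3 * √(x * (a * T)) + √(T * G / 2))) := by
        rw [mul_assoc x]
        ring
    _ ≤ 30 * (N ^ 2 * (x * L) * √(x * (a * T) * G)) := by linarith
    _ = 30 * N ^ 2 * x ^ (3 / 2 : ℝ) * √(a * T) * L * √G := by
        rw [hx32, Real.sqrt_mul (by positivity), Real.sqrt_mul (by positivity)]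
        ring

end Numerics

/-! ### The bound on the good events -/

section Bound

lemma one_sub_add_le_measureReal {Ω : Type*} {mΩ : MeasurableSpace Ω} {P : Measure Ω}
    [IsProbabilityMeasure P] {B₁ B₂ G : Set Ω} {ε₁ ε₂ : ℝ} (h₁ : P.real B₁ ≤ ε₁)
    (h₂ : P.real B₂ ≤ ε₂) (hG : ∀ ω, ω ∉ B₁ → ω ∉ B₂ → ω ∈ G) : 1 - (ε₁ + ε₂) ≤ P.real G := by
  have hcover : (Set.univ : Set Ω) ⊆ G ∪ (B₁ ∪ B₂) := fun ω _ => by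
    by_contra! hω
    simp only [Set.mem_union, not_or] at hω
    exact hω.1 (hG ω hω.2.1 hω.2.2)
  have huniv := (probReal_univ (μ := P)).symm.trans_le (measureReal_mono hcover)
  linarith [measureReal_union_le (μ := P) G (B₁ ∪ B₂), measureReal_union_le (μ := P) B₁ B₂]

variable {X A : Type*} [Fintype X] [Fintype A] {N T : ℕ} {α δ : ℝ}

lemma one_le_card_mul [Nonempty X] [Nonempty A] (hN : 0 < N) (hT : 0 < T) :
    (1 : ℝ) ≤ Fintype.card X * Fintype.card A * N * T := by
  exact_mod_cast Nat.succ_le_of_lt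
    (mul_pos (mul_pos (mul_pos Fintype.card_pos Fintype.card_pos) hN) hT)

lemma bonusConst_sq [Nonempty X] [Nonempty A] (hN : 0 < N) (hT : 0 < T) (hδ0 : 0 < δ)
    (hδ : δ ≤ 1 / 3) : bonusConst X A N T δ ^ 2 =
      2 * (Fintype.card X * Real.log (Fintype.card X * Fintype.card A * N * T / δ)) := by
  have := one_le_log_div (one_le_card_mul (X := X) (A := A) hN hT) hδ0 hδ
  rw [bonusConst, Real.sq_sqrt (by positivity), mul_assoc]

lemma one_le_bonusConst [Nonempty X] [Nonempty A] (hN : 0 < N) (hT : 0 < T) (hδ0 : 0 < δ)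
    (hδ : δ ≤ 1 / 3) : 1 ≤ bonusConst X A N T δ := by
  have hlog := one_le_log_div (one_le_card_mul (X := X) (A := A) hN hT) hδ0 hδ
  have hX : (1 : ℝ) ≤ Fintype.card X := Nat.one_le_cast.2 Fintype.card_pos
  have hC0 : 0 ≤ bonusConst X A N T δ := Real.sqrt_nonneg _
  rw [← one_le_sq_iff₀ hC0, bonusConst_sq hN hT hδ0 hδ]
  linarith [one_le_mul_of_one_le_of_one_le hX hlog]

variable [DecidableEq X] [DecidableEq A] {p : Kernel X A N} {ρ : X × A → ℝ}

lemma sum_pairBonus_trueOcc_le {o : ℕ → Traj X A N} {π : ℕ → Policy X A N} {a : ℝ}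
    (h : ∀ n, ∑ t ∈ Finset.range T, ∑ y, trueOcc p ρ π t n.castSucc y * bonus T δ o t n y ≤
      ∑ t ∈ Finset.range T, bonus T δ o t n (o t n.castSucc) + bonusConst X A N T δ * a) :
    ∑ t ∈ Finset.range T, pairBonus (trueOcc p ρ π t) (bonus T δ o t) ≤
      N * (bonusConst X A N T δ *
        (3 * √((Fintype.card X : ℝ) * Fintype.card A * T) + a)) := by
  have hobserved : ∀ n, ∑ t ∈ Finset.range T, bonus T δ o t n (o t n.castSucc) ≤
      bonusConst X A N T δ * (3 * √((Fintype.card X : ℝ) * Fintype.card A * T)) := fun n => by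
    simp only [bonus, div_eq_mul_one_div (bonusConst X A N T δ), ← Finset.mul_sum]
    exact mul_le_mul_of_nonneg_left (sum_inv_sqrt_visits_le o T n) (Real.sqrt_nonneg _)
  simp only [pairBonus]
  rw [Finset.sum_comm]
  calc ∑ n, ∑ t ∈ Finset.range T, ∑ y, trueOcc p ρ π t n.castSucc y * bonus T δ o t n y
      ≤ ∑ _ : Fin N, bonusConst X A N T δ *
          (3 * √((Fintype.card X : ℝ) * Fintype.card A * T) + a) :=
        Finset.sum_le_sum fun n _ => (h n).trans (by linarith [hobserved n])
    _ = _ := by simp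

lemma sum_l1_initDist_sub_le_thirty_mul [Nonempty X] [Nonempty A] (hN : 0 < N) (hT : 0 < T)
    (hp : IsKernel p) (hρ : ρ ∈ stdSimplex ℝ (X × A)) (hα0 : 0 ≤ α) (hα1 : α < 1)
    (hfeas : ∃ π : Policy X A N, IsPeriodic p ρ π) (hcontr : PeriodicContraction p ρ α)
    (hδ0 : 0 < δ) (hδ : δ ≤ 1 / 3) {o : ℕ → Traj X A N} {π : ℕ → Policy X A N}
    (hπ : ∀ t < T, IsPolicy (π t))
    (hupd : ∀ t, t + 1 < T → (feasibleSet p ρ T δ α o π (t + 1)).Nonempty →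
      estOcc p ρ o π (t + 1) ∈ feasibleSet p ρ T δ α o π (t + 1))
    (hacc : ∀ t < T, t ≠ 0 → IsAccurate p T δ o t)
    (hbonus : ∀ n, ∑ t ∈ Finset.range T, ∑ y, trueOcc p ρ π t n.castSucc y * bonus T δ o t n y ≤
      ∑ t ∈ Finset.range T, bonus T δ o t n (o t n.castSucc) +
        bonusConst X A N T δ * √(T * Real.log (N / δ) / 2)) :
    ∑ t ∈ Finset.range T, l1 (initDist p ρ π (t + 1) - ρ) ≤
      30 * (N : ℝ) ^ 2 / (1 - α) * (Fintype.card X : ℝ) ^ (3 / 2 : ℝ) *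
        √((Fintype.card A : ℝ) * T) *
        Real.log ((Fintype.card X : ℝ) * Fintype.card A * N * T / δ) *
        √(Real.log ((N : ℝ) / δ)) := by
  have hX : (1 : ℝ) ≤ Fintype.card X := Nat.one_le_cast.2 Fintype.card_pos
  have hA : (1 : ℝ) ≤ Fintype.card A := Nat.one_le_cast.2 Fintype.card_pos
  have hN1 : (1 : ℝ) ≤ N := Nat.one_le_cast.2 hN
  have hT1 : (1 : ℝ) ≤ T := Nat.one_le_cast.2 hT
  have hC0 : 0 ≤ bonusConst X A N T δ := Real.sqrt_nonneg _
  have hrecursion := sum_l1_initDist_sub_le hp hρ hα0 hfeas hcontr hπ hacc hupd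
  have hsum := mul_le_mul_of_nonneg_left (sum_pairBonus_trueOcc_le hbonus)
    (by positivity : 0 ≤ 2 * (1 + N * bonusConst X A N T δ))
  have hconst := two_add_two_mul_le_thirty_mul hN1 hX hA hT1
    (one_le_log_div (one_le_card_mul (X := X) (A := A) hN hT) hδ0 hδ)
    (one_le_log_div hN1 hδ0 hδ) hC0 (bonusConst_sq hN hT hδ0 hδ)
  simp only [div_mul_eq_mul_div]
  rw [le_div_iff₀ (sub_pos.2 hα1), mul_comm]
  linarith

variable {Ω : Type*} {mΩ : MeasurableSpace Ω} {P : Measure Ω} [IsProbabilityMeasure P]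
  {ℱ : Filtration ℕ mΩ} {o : Ω → ℕ → Traj X A N} {π : ℕ → Ω → Policy X A N}

lemma IsObservationProcess.measureReal_not_isAccurate_le_two_mul [Nonempty X] [Nonempty A]
    (hobs : IsObservationProcess P p ρ T ℱ o π) (hp : IsKernel p) (hρ : ρ ∈ stdSimplex ℝ (X × A))
    (hN : 0 < N) (hT : 0 < T) (hδ0 : 0 < δ) (hδ : δ ≤ 1 / 3) :
    P.real {ω | ∃ t < T, t ≠ 0 ∧ ¬ IsAccurate p T δ (o ω) t} ≤ 2 * δ := by
  refine (hobs.measureReal_not_isAccurate_le hp hρ (one_le_bonusConst hN hT hδ0 hδ)).trans ?_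
  rw [bonusConst_sq hN hT hδ0 hδ, mul_div_cancel_left₀ _ two_ne_zero]
  exact two_pow_mul_exp_le Fintype.card_pos hδ0
    (by linarith [one_le_card_mul (X := X) (A := A) hN hT])

end Bound

end PeriodicMDP

theorem mainTheorem5_general {X A Ω : Type*} [Fintype X] [Fintype A] [DecidableEq X]
    [DecidableEq A] {mΩ : MeasurableSpace Ω} {P : Measure Ω} [IsProbabilityMeasure P]
    {N T : ℕ} (hN : 0 < N) (hT : 0 < T)
    {p : PeriodicMDP.Kernel X A N} (hp : PeriodicMDP.IsKernel p)
    {ρ : X × A → ℝ} (hρ : ρ ∈ stdSimplex ℝ (X × A)) {α : ℝ} (hα0 : 0 ≤ α) (hα1 : α < 1)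
    (hfeas : ∃ π : PeriodicMDP.Policy X A N, PeriodicMDP.IsPeriodic p ρ π)
    (hcontr : PeriodicMDP.PeriodicContraction p ρ α) {δ : ℝ} (hδ0 : 0 < δ)
    {ℱ : Filtration ℕ mΩ} {o : Ω → ℕ → PeriodicMDP.Traj X A N}
    {π : ℕ → Ω → PeriodicMDP.Policy X A N}
    (hobs : PeriodicMDP.IsObservationProcess P p ρ T ℱ o π)
    (hupd : ∀ t, t + 1 < T → ∀ ω,
      (PeriodicMDP.feasibleSet p ρ T δ α (o ω) (fun s => π s ω) (t + 1)).Nonempty →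
        PeriodicMDP.estOcc p ρ (o ω) (fun s => π s ω) (t + 1) ∈
          PeriodicMDP.feasibleSet p ρ T δ α (o ω) (fun s => π s ω) (t + 1)) :
    1 - 3 * δ ≤ P.real {ω |
      ∑ t ∈ Finset.range T,
          PeriodicMDP.l1 (PeriodicMDP.initDist p ρ (fun s => π s ω) (t + 1) - ρ) ≤
        30 * (N : ℝ) ^ 2 / (1 - α) * (Fintype.card X : ℝ) ^ (3 / 2 : ℝ) *
          √((Fintype.card A : ℝ) * T) *
          Real.log ((Fintype.card X : ℝ) * Fintype.card A * N * T / δ) *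
          √(Real.log ((N : ℝ) / δ))} := by
  rcases lt_or_ge (1 / 3) δ with hδ | hδ
  · exact (by linarith : 1 - 3 * δ ≤ 0).trans measureReal_nonneg
  obtain ⟨y⟩ : Nonempty (X × A) := by
    by_contra! hempty
    simpa using hρ.2
  have : Nonempty X := ⟨y.1⟩
  have : Nonempty A := ⟨y.2⟩
  have hδN : δ ≤ N := hδ.trans (by linarith [(Nat.one_le_cast (α := ℝ)).2 hN])
  have hestimate := hobs.measureReal_not_isAccurate_le_two_mul hp hρ hN hT hδ0 hδ
  have hbonus := hobs.measureReal_sum_bonus_lt_le hp hρ hN hT hδ0 hδN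
    (PeriodicMDP.one_le_bonusConst hN hT hδ0 hδ)
  rw [show 3 * δ = 2 * δ + δ by ring]
  refine PeriodicMDP.one_sub_add_le_measureReal hestimate hbonus fun ω hω₁ hω₂ => ?_
  simp only [Set.mem_ofPred_eq, not_exists, not_and, not_not, not_lt] at hω₁ hω₂
  exact PeriodicMDP.sum_l1_initDist_sub_le_thirty_mul hN hT hp hρ hα0 hα1 hfeas hcontr hδ0 hδ
    (fun t ht => hobs.policy t ht ω) (fun t ht => hupd t ht ω) hω₁ hω₂

theorem mainTheorem5 {X A J Ω : Type*} [Fintype X] [Fintype A] [DecidableEq X] [DecidableEq A]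
    [Fintype J] {mΩ : MeasurableSpace Ω} (P : MeasureTheory.Measure Ω)
    [MeasureTheory.IsProbabilityMeasure P]
    (N T : ℕ) (hN : 0 < N) (hT : 0 < T)
    (p : PeriodicMDP.Kernel X A N) (hp : PeriodicMDP.IsKernel p)
    (ρ : X × A → ℝ) (hρ : ρ ∈ stdSimplex ℝ (X × A))
    (α : ℝ) (hα0 : 0 ≤ α) (hα1 : α < 1)
    (hfeas : ∃ π : PeriodicMDP.Policy X A N, PeriodicMDP.IsPeriodic p ρ π)
    (hcontr : PeriodicMDP.PeriodicContraction p ρ α)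
    (δ : ℝ) (hδ0 : 0 < δ) (hδ1 : δ < 1) (η : ℝ) (hη : 0 < η) (ℓ : ℝ)
    (ψ : PeriodicMDP.Occ X A N → ℝ)
    (f : ℕ → Ω → Fin N → (X × A → ℝ) → ℝ) (g : ℕ → Ω → Fin N → X × A → ℝ)
    (h : ℕ → Ω → PeriodicMDP.Occ X A N)
    (ℱ 𝒢 : MeasureTheory.Filtration ℕ mΩ)
    (Z : ℕ → J → Ω → PeriodicMDP.Traj X A N) (sel : ℕ → Ω → J)
    (π : ℕ → Ω → PeriodicMDP.Policy X A N)
    (hprot : PeriodicMDP.IsProtocol P p ρ T ℱ 𝒢 Z sel π)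
    (halg : PeriodicMDP.IsMDPPK p ρ T δ α η ℓ ψ f g h Z sel π) :
    1 - (2 + (T : ℝ)) * δ ≤ P.real {ω |
      ∑ t ∈ Finset.range T,
          PeriodicMDP.l1 (PeriodicMDP.initDist p ρ (fun s => π s ω) (t + 1) - ρ) ≤
        30 * (N : ℝ) ^ 2 / (1 - α) * (Fintype.card X : ℝ) ^ (3 / 2 : ℝ) *
          Real.sqrt ((Fintype.card A : ℝ) * (T : ℝ)) *
          Real.log ((Fintype.card X : ℝ) * (Fintype.card A : ℝ) * (N : ℝ) * (T : ℝ) / δ) *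
          Real.sqrt (Real.log ((N : ℝ) / δ))} := by
  refine le_trans ?_ (mainTheorem5_general hN hT hp hρ hα0 hα1 hfeas hcontr hδ0
    (hprot.isObservationProcess hp) fun t ht ω hne => (halg.update t ht ω hne).1)
  nlinarith [(Nat.one_le_cast (α := ℝ)).2 hT]
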